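/- For a closed convex set $S\subseteq\mathbb R^n$ containing the origin, let $\gamma(S,x)=\inf\{\gamma\ge 0: x\in\gamma S\}\in[0,\infty]$ be its Minkowski function and $S^\circ=\{y: y^{\top}x\le 1\ \forall x\in S\}$ its polar. A polyhedral cone is a finite intersection of halfspaces $\{x: a^{\top}x\ge 0\}$; the dimension of a set is that of its affine hull. A conic partition of $\mathbb R^n$ is a finite family of polyhedral cones $P_i$ with nonempty interior such that $\bigcup_i P_i=\mathbb R^n$ and $\dim(P_i\cap P_j)<n$ for $i\ne j$. The set $S$ is the piecewise semi-ellipsoid represented by a conic partition $(P_i)$ with symmetric positive semidefinite matrices $(Q_i)$ if $\gamma(S,x)=\sqrt{x^{\top}Q_ix}$ for $x\in P_i$ and, whenever $\dim(P_i\cap P_j)=n-1$ and $v$ is the normal of the hyperplane $\operatorname{aff}(P_i\cap P_j)$ directed towards $P_i$, one has $x^{\top}Q_ix=x^{\top}Q_jx$ and $v^{\top}Q_ix\ge v^{\top}Q_jx$ for all $x\in P_i\cap P_j$. Let $S$ be the piecewise semi-ellipsoid represented by $(P_i)_{i=1}^m$ and $(Q_i)_{i=1}^m$. For nonempty $I\subseteq\{1,\dots,m\}$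 put $$C_I=\bigcap_{i\in I}P_i,\qquad K_I=\operatorname{conv}\bigcup_{i\in I}Q_iC_I,\qquad M_I=E_I^{\top}(E_IQ_iE_I^{\top})^{+}E_I\quad(i\in I),$$ where $E_I$ is the orthogonal projection onto $\operatorname{aff}C_I$ and $^+$ is the Moore–Penrose inverse. Call $I$ active if $I=\{i: x\in P_i\}$ for some $x\in\mathbb R^n$. Then: 1. All $Q_iP_i$ and all $K_I$ are polyhedral cones, and $E_IQ_iE_I^{\top}$ does not depend on $i\in I$. 2. $\gamma(S^\circ,y)=\sqrt{y^{\top}Q_i^{+}y}$ for $y\in Q_iP_i$. 3. $\gamma(S^\circ,y)=\sqrt{y^{\top}M_Iy}$ for $y\in K_I$, for every nonempty $I$ for which some point $x\in C_I$ satisfies: every $P_j$ containing $x$ contains $C_I$ (in particular for every active $I$); and for every nonempty $I$ if the partition is face-to-face, that is, if $P_i\cap P_j$ is a face of $P_i$ for all $i,j$. 4. For an arbitrary nonempty $I$, $\gamma(S^\circ,y)=\sqrt{y^{\top}M_Iy}$ for every $y\in\operatorname{conv}\{Q_ix: i\in I\}$ with $x\in C_I$. 5. Each $\{i\}$ is active,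 with $K_{\{i\}}=Q_iP_i$ and $M_{\{i\}}=Q_i^{+}$. The union of the cones $K_I$ over all active $I$ is $\{y:\gamma(S^\circ,y)<\infty\}$, and $\dim(K_I\cap K_J)<n$ for distinct active $I,J$. 6. $S^\circ$ is piecewise semi-ellipsoidal if and only if $S$ is bounded. In that case $S^\circ$ is the piecewise semi-ellipsoid represented by the conic partition made of the full-dimensional cones among the $K_I$, $I$ active (which include the full-dimensional cones $Q_iP_i$), with the matrices $M_I$ (with $M_{\{i\}}=Q_i^{+}$). -/

import Mathlib

open scoped Matrix NNReal ENNReal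

noncomputable section

/-- Euclidean space of dimension `n`. -/
abbrev Euc (n : ℕ) : Type := EuclideanSpace ℝ (Fin n)

/-- The dimension of a set: the dimension of its affine hull. -/
def affDim {n : ℕ} (C : Set (Euc n)) : ℕ := Module.finrank ℝ (vectorSpan ℝ C)

/-- The product of the square matrix `Q` and the vector `x`. -/
def matAct {n : ℕ} (Q : Matrix (Fin n) (Fin n) ℝ) (x : Euc n) : Euc n :=
  Matrix.toEuclideanLin Q x

/-- The quadratic form `x ↦ xᵀ Q x`. -/
def quadForm {n : ℕ} (Q : Matrix (Fin n) (Fin n) ℝ) (x : Euc n) : ℝ :=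
  inner ℝ x (matAct Q x)

/-- The four Penrose equations: `B` is a Moore-Penrose inverse of the real square matrix `A`. -/
structure IsMoorePenroseInverse {n : ℕ} (A B : Matrix (Fin n) (Fin n) ℝ) : Prop where
  mul_mul_left : A * B * A = A
  mul_mul_right : B * A * B = B
  symm_left : (A * B)ᵀ = A * B
  symm_right : (B * A)ᵀ = B * A

theorem IsMoorePenroseInverse.unique {n : ℕ} {A B C : Matrix (Fin n) (Fin n) ℝ}
    (hB : IsMoorePenroseInverse A B) (hC : IsMoorePenroseInverse A C) : B = C := by
  have h1 : A * B = A * C := by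
    calc A * B = (A * B)ᵀ := hB.symm_left.symm
      _ = ((A * C) * (A * B))ᵀ := by rw [← mul_assoc, hC.mul_mul_left]
      _ = (A * B) * (A * C) := by rw [Matrix.transpose_mul, hB.symm_left, hC.symm_left]
      _ = A * C := by rw [← mul_assoc, hB.mul_mul_left]
  have h2 : B * A = C * A := by
    calc B * A = (B * A)ᵀ := hB.symm_right.symm
      _ = ((B * A) * (C * A))ᵀ := by
        rw [mul_assoc B A, ← mul_assoc A C, hC.mul_mul_left]
      _ = (C * A) * (B * A) := by rw [Matrix.transpose_mul, hB.symm_right, hC.symm_right]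
      _ = C * A := by rw [mul_assoc C A, ← mul_assoc A B, hB.mul_mul_left]
  calc B = B * A * B := hB.mul_mul_right.symm
    _ = C * A * C := by rw [h2, mul_assoc, h1, mul_assoc]
    _ = C := hC.mul_mul_right

theorem exists_isMoorePenroseInverse {n : ℕ} {A : Matrix (Fin n) (Fin n) ℝ}
    (hA : A.IsHermitian) : ∃ B, IsMoorePenroseInverse A B := by
  have hsa : IsSelfAdjoint A := hA
  have hfin : (spectrum ℝ A).Finite := Matrix.finite_real_spectrum
  have hc : ∀ f : ℝ → ℝ, ContinuousOn f (spectrum ℝ A) := fun f => hfin.continuousOn f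
  have hid : cfc (fun x : ℝ => x) A = A := cfc_id' ℝ A
  have hT : ∀ f : ℝ → ℝ, (cfc f A)ᵀ = cfc f A := fun f => by
    have h := (cfc_predicate f A : IsSelfAdjoint (cfc f A)).star_eq
    rwa [Matrix.star_eq_conjTranspose, Matrix.conjTranspose_eq_transpose_of_trivial] at h
  have e1 : A * cfc (fun x : ℝ => x⁻¹) A = cfc (fun x : ℝ => x * x⁻¹) A := by
    rw [cfc_mul (fun x : ℝ => x) (fun x : ℝ => x⁻¹) A (hc _) (hc _), hid]
  have e2 : cfc (fun x : ℝ => x⁻¹) A * A = cfc (fun x : ℝ => x⁻¹ * x) A := by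
    rw [cfc_mul (fun x : ℝ => x⁻¹) (fun x : ℝ => x) A (hc _) (hc _), hid]
  refine ⟨cfc (fun x : ℝ => x⁻¹) A, ?_, ?_, ?_, ?_⟩
  · calc A * cfc (fun x : ℝ => x⁻¹) A * A
        = cfc (fun x : ℝ => x * x⁻¹) A * cfc (fun x : ℝ => x) A := by rw [e1, hid]
      _ = cfc (fun x : ℝ => x * x⁻¹ * x) A := (cfc_mul _ _ A (hc _) (hc _)).symm
      _ = cfc (fun x : ℝ => x) A := by
        congr 1
        funext x
        exact mul_inv_mul_cancel x
      _ = A := hid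
  · rw [e2, ← cfc_mul _ _ A (hc _) (hc _)]
    congr 1
    funext x
    rcases eq_or_ne x 0 with rfl | h
    · simp
    · field_simp
  · rw [e1, hT]
  · rw [e2, hT]

open Classical in
/-- The Moore-Penrose pseudoinverse `A⁺` (by the two theorems above, it exists and is unique for
every symmetric matrix `A`; it is only used for such matrices). -/
def pinv {n : ℕ} (A : Matrix (Fin n) (Fin n) ℝ) : Matrix (Fin n) (Fin n) ℝ :=
  if h : ∃ B, IsMoorePenroseInverse A B then h.choose else 0

theorem pinv_spec {n : ℕ} {A : Matrix (Fin n) (Fin n) ℝ} (hA : A.IsHermitian) :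
    IsMoorePenroseInverse A (pinv A) := by
  have h := exists_isMoorePenroseInverse hA
  rw [pinv, dif_pos h]
  exact h.choose_spec

/-- The Minkowski function (gauge) of `S`, with values in `[0, ∞]`. -/
def minkowski {n : ℕ} (S : Set (Euc n)) (x : Euc n) : ℝ≥0∞ :=
  ⨅ (γ : ℝ≥0) (_ : ∃ s ∈ S, x = (γ : ℝ) • s), (γ : ℝ≥0∞)

/-- The (one-sided) polar set of `S`. -/
def polarSet {n : ℕ} (S : Set (Euc n)) : Set (Euc n) :=
  {y | ∀ x ∈ S, inner ℝ y x ≤ 1}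

/-- A polyhedral cone: a finite intersection of halfspaces `{x | aᵀ x ≥ 0}`. -/
def IsPolyhedralCone {n : ℕ} (C : Set (Euc n)) : Prop :=
  ∃ A : Finset (Euc n), C = {x | ∀ a ∈ A, 0 ≤ inner ℝ a x}

/-- A conic partition of `ℝⁿ`. -/
structure IsConicPartition {n : ℕ} {ι : Type} (P : ι → Set (Euc n)) : Prop where
  finite : Finite ι
  polyhedral : ∀ i, IsPolyhedralCone (P i)
  interior_nonempty : ∀ i, (interior (P i)).Nonempty
  dim_inter_lt : ∀ i j, i ≠ j → affDim (P i ∩ P j) < n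
  cover : ⋃ i, P i = Set.univ

/-- The closed convex set `S ∋ 0` is piecewise semi-ellipsoidal, as witnessed by the conic partition
`P` and the positive semidefinite matrices `Q`. In the last field, `v` is a normal of the
hyperplane spanned by `P i ∩ P j` that is directed towards `P i`. -/
structure IsPiecewiseSemiEllipsoidOf {n : ℕ} {ι : Type} (S : Set (Euc n))
    (P : ι → Set (Euc n)) (Q : ι → Matrix (Fin n) (Fin n) ℝ) : Prop where
  isClosed : IsClosed S
  convex : Convex ℝ S
  zero_mem : (0 : Euc n) ∈ S
  partition : IsConicPartition P
  posSemidef : ∀ i, (Q i).PosSemidef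
  minkowski_eq : ∀ i, ∀ x ∈ P i, minkowski S x = ENNReal.ofReal (√(quadForm (Q i) x))
  continuity : ∀ i j, affDim (P i ∩ P j) + 1 = n →
    ∀ x ∈ P i ∩ P j, quadForm (Q i) x = quadForm (Q j) x
  convexity : ∀ i j, affDim (P i ∩ P j) + 1 = n →
    ∀ v : Euc n, v ≠ 0 → (∀ x ∈ P i ∩ P j, inner ℝ v x = 0) → (∀ x ∈ P i, 0 ≤ inner ℝ v x) →
      ∀ x ∈ P i ∩ P j, inner ℝ v (matAct (Q j) x) ≤ inner ℝ v (matAct (Q i) x)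

/-- A set is piecewise semi-ellipsoidal. -/
def IsPiecewiseSemiEllipsoidal {n : ℕ} (S : Set (Euc n)) : Prop :=
  ∃ (m : ℕ) (P : Fin m → Set (Euc n)) (Q : Fin m → Matrix (Fin n) (Fin n) ℝ),
    IsPiecewiseSemiEllipsoidOf S P Q

section Polar

variable {n : ℕ} {ι : Type} (P : ι → Set (Euc n)) (Q : ι → Matrix (Fin n) (Fin n) ℝ)

/-- The intersection `⋂_{i ∈ I} P_i`. -/
def interCone (I : Set ι) : Set (Euc n) := ⋂ i ∈ I, P i

/-- The cone `conv_{i ∈ I} Q_i (⋂_{j ∈ I} P_j)`: the convex hull of the union of the images. -/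
def polarCone (I : Set ι) : Set (Euc n) :=
  convexHull ℝ (⋃ i ∈ I, matAct (Q i) '' interCone P I)

/-- The matrix `E_I` of the orthogonal projection onto the affine hull of `⋂_{i ∈ I} P_i`. For
polyhedral cones this affine hull contains the origin and so is its own direction, the
`vectorSpan`. -/
def projMatrix (I : Set ι) : Matrix (Fin n) (Fin n) ℝ :=
  Matrix.toEuclideanLin.symm ((vectorSpan ℝ (interCone P I)).starProjection : Euc n →ₗ[ℝ] Euc n)

/-- The matrix `E_Iᵀ (E_I Q_i E_Iᵀ)⁺ E_I`. -/
def polarMatrix (I : Set ι) (i : ι) : Matrix (Fin n) (Fin n) ℝ :=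
  (projMatrix P I)ᵀ * pinv (projMatrix P I * Q i * (projMatrix P I)ᵀ) * projMatrix P I

/-- `I` is the set of all the indices of the cones that contain some point `x`. -/
def IsActive (I : Set ι) : Prop := ∃ x : Euc n, I = {i | x ∈ P i}

/-- Some point of `⋂_{i ∈ I} P_i` lies in no `P_j` other than those that contain all of
`⋂_{i ∈ I} P_i`. -/
def IsCell (I : Set ι) : Prop :=
  ∃ x ∈ interCone P I, ∀ j, x ∈ P j → interCone P I ⊆ P j

/-- The partition is face-to-face: `P_i ∩ P_j` is a face of `P_i`, for all `i` and `j`. -/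
def IsFaceToFace : Prop := ∀ i j, IsExtreme ℝ (P i) (P i ∩ P j)

/-- The indices of the conic partition of the polar: the active sets `I` for which the cone
`conv_{i ∈ I} Q_i (⋂_{j ∈ I} P_j)` is full-dimensional. -/
def PolarIndex : Type :=
  {I : Set ι // IsActive P I ∧ (interior (polarCone P Q I)).Nonempty}

end Polar

end

/-! Half the squared gauge of `S` is a finite convex function that is quadratic on each `P i`, with
gradient `Q_i x` there. A subgradient `y` at `x` satisfies γ(S°, y) = γ(S, x)
(`IsGaugeSubgradient.minkowski_polarSet`), so the polar gauge is known at `y` once a point with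
subgradient `y` is known. The vectors `Q_i x` with `x ∈ P i` are subgradients at `x`, and their
convex hull contains all the others (`mem_convexHull_of_isGaugeSubgradient`).

An element of `K_I` is a sum `y = ∑ Q_i f_i` with possibly different `f_i ∈ C_I`. On a cell it is
still a subgradient, at `x = ∑ f_i` (`isGaugeSubgradient_of_isSumPair`): towards any `z` there is
one cone `P i ⊇ C_I` in whose directions `Q_i` dominates every other `Q_j` on `C_I`. All `Q_i` with
`i ∈ I` induce the same bilinear form on the span of `C_I`, so `y` and `Q_i x` have the same
projection onto it, and `M_I` recovers `xᵀ Q_i x` from that projection (`quadForm_polarMatrix`).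

Every `y` in the domain of the polar gauge is a limit of subgradients, obtained from a regularised
minimisation; the union of the finitely many closed cones `K_I` therefore contains it. In the
interior of `K_I` the vector `y` is a subgradient only at `M_I y`, whose active set is exactly `I`,
and this prevents overlaps. Finally, `S` is bounded exactly when the polar gauge is finite
everywhere; in that case the full-dimensional `K_I` already cover the space, and monotonicity of the
gradients `M_I y` gives the convexity condition across common facets. -/

/-! ### Polyhedral cones and their linear images -/

/-- A subset of a real vector space cut out by finitely many linear inequalities `0 ≤ a x`. -/
def IsFiniteDualCone {V : Type*} [AddCommGroup V] [Module ℝ V] (C : Set V) : Prop :=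
  ∃ A : Set (V →ₗ[ℝ] ℝ), A.Finite ∧ C = {x | ∀ a ∈ A, 0 ≤ a x}

namespace IsFiniteDualCone

variable {V W : Type*} [AddCommGroup V] [Module ℝ V] [AddCommGroup W] [Module ℝ W]

theorem preimage {C : Set W} (hC : IsFiniteDualCone C) (f : V →ₗ[ℝ] W) :
    IsFiniteDualCone (f ⁻¹' C) := by
  obtain ⟨A, hA, rfl⟩ := hC
  refine ⟨(fun a => a ∘ₗ f) '' A, hA.image _, ?_⟩
  ext x
  simp

theorem iInter {κ : Type*} [Finite κ] {C : κ → Set V} (hC : ∀ k, IsFiniteDualCone (C k)) :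
    IsFiniteDualCone (⋂ k, C k) := by
  choose A hA hCA using hC
  refine ⟨⋃ k, A k, Set.finite_iUnion hA, ?_⟩
  ext x
  simp only [Set.mem_iInter, hCA, Set.mem_ofPred_eq, Set.mem_iUnion]
  exact ⟨fun h a ⟨k, hk⟩ => h k a hk, fun h k a hk => h a ⟨k, hk⟩⟩

theorem inter {C D : Set V} (hC : IsFiniteDualCone C) (hD : IsFiniteDualCone D) :
    IsFiniteDualCone (C ∩ D) := by
  rw [Set.inter_eq_iInter]
  exact iInter (fun b => by cases b <;> assumption)

theorem zero [FiniteDimensional ℝ V] : IsFiniteDualCone ({0} : Set V) := by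
  let b := Module.finBasis ℝ V
  refine ⟨Set.range b.coord ∪ Set.range (fun i => -b.coord i),
    (Set.finite_range _).union (Set.finite_range _), ?_⟩
  ext x
  simp only [Set.mem_singleton_iff, Set.mem_ofPred_eq]
  constructor
  · rintro rfl a _
    simp
  · intro h
    refine b.ext_elem fun i => ?_
    have h1 := h (b.coord i) (Or.inl ⟨i, rfl⟩)
    have h2 := h (-b.coord i) (Or.inr ⟨i, rfl⟩)
    simp only [LinearMap.neg_apply, Module.Basis.coord_apply] at h1 h2
    simp only [map_zero, Finsupp.coe_zero, Pi.zero_apply]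
    linarith

end IsFiniteDualCone

/-- Finitely many lower bounds that do not exceed finitely many upper bounds can be separated. -/
theorem exists_between_of_finite {s t : Set ℝ} (hs : s.Finite) (ht : t.Finite)
    (h : ∀ a ∈ s, ∀ b ∈ t, a ≤ b) : ∃ c, (∀ a ∈ s, a ≤ c) ∧ ∀ b ∈ t, c ≤ b := by
  rcases s.eq_empty_or_nonempty with rfl | hne
  · rcases t.eq_empty_or_nonempty with rfl | hne
    · exact ⟨0, by simp, by simp⟩
    · obtain ⟨c, -, hc⟩ := Set.exists_min_image t id ht hne
      exact ⟨c, by simp, hc⟩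
  · obtain ⟨c, hcs, hc⟩ := Set.exists_max_image s id hs hne
    exact ⟨c, hc, h c hcs⟩

namespace IsFiniteDualCone

open scoped Pointwise

variable {V W : Type*} [AddCommGroup V] [Module ℝ V] [AddCommGroup W] [Module ℝ W]

/-- Fourier-Motzkin elimination of one variable. -/
theorem add_span_singleton {C : Set V} (hC : IsFiniteDualCone C) (w : V) :
    IsFiniteDualCone (C + (Submodule.span ℝ {w} : Set V)) := by
  obtain ⟨A, hA, rfl⟩ := hC
  refine ⟨{a ∈ A | a w = 0} ∪ Set.image2 (fun a b : V →ₗ[ℝ] ℝ => a w • b - b w • a)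
    {a ∈ A | 0 < a w} {b ∈ A | b w < 0},
    (hA.subset (Set.sep_subset _ _)).union
      ((hA.subset (Set.sep_subset _ _)).image2 _ (hA.subset (Set.sep_subset _ _))), ?_⟩
  ext x
  simp only [Set.mem_add, Set.mem_ofPred_eq, SetLike.mem_coe, Submodule.mem_span_singleton]
  constructor
  · rintro ⟨d, hd, _, ⟨t, rfl⟩, rfl⟩ a (⟨ha, ha0⟩ | ⟨a, ⟨ha, ha0⟩, b, ⟨hb, hb0⟩, rfl⟩)
    · simpa [ha0] using hd a ha
    · have h1 := hd a ha
      have h2 := hd b hb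
      simp only [LinearMap.sub_apply, LinearMap.smul_apply, map_add, map_smul, smul_eq_mul]
      nlinarith [mul_nonneg ha0.le h2, mul_nonneg (neg_nonneg.2 hb0.le) h1]
  · intro h
    -- The point `x - c • w` lies in the cone iff `c ≤ a x / a w` when `a w > 0` and `c ≥ a x / a w`
    -- when `a w < 0`, besides the inequalities with `a w = 0`. The combined inequalities say that
    -- no lower bound exceeds an upper bound.
    obtain ⟨c, hc1, hc2⟩ := exists_between_of_finite
      (s := (fun a : V →ₗ[ℝ] ℝ => a x / a w) '' {b ∈ A | b w < 0})
      (t := (fun a : V →ₗ[ℝ] ℝ => a x / a w) '' {a ∈ A | 0 < a w})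
      ((hA.subset (Set.sep_subset _ _)).image _) ((hA.subset (Set.sep_subset _ _)).image _) (by
        rintro _ ⟨b, ⟨hb, hb0⟩, rfl⟩ _ ⟨a, ⟨ha, ha0⟩, rfl⟩
        have := h _ (Or.inr ⟨a, ⟨ha, ha0⟩, b, ⟨hb, hb0⟩, rfl⟩)
        simp only [LinearMap.sub_apply, LinearMap.smul_apply, smul_eq_mul] at this
        rw [div_le_iff_of_neg hb0, div_mul_eq_mul_div, div_le_iff₀ ha0]
        linarith)
    refine ⟨x - c • w, fun a ha => ?_, c • w, ⟨c, rfl⟩, by abel⟩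
    simp only [map_sub, map_smul, smul_eq_mul]
    rcases lt_trichotomy (a w) 0 with h0 | h0 | h0
    · have := hc1 _ ⟨a, ⟨ha, h0⟩, rfl⟩
      rw [div_le_iff_of_neg h0] at this
      linarith
    · rw [h0]
      simpa using h a (Or.inl ⟨ha, h0⟩)
    · have := hc2 _ ⟨a, ⟨ha, h0⟩, rfl⟩
      rw [le_div_iff₀ h0] at this
      linarith

theorem add_submodule {C : Set V} (hC : IsFiniteDualCone C) {N : Submodule ℝ V} (hN : N.FG) :
    IsFiniteDualCone (C + (N : Set V)) := by
  induction N, hN using Submodule.fg_induction generalizing C with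
  | singleton w => exact hC.add_span_singleton w
  | sup N₁ N₂ _ _ h₁ h₂ =>
    rw [Submodule.coe_sup, ← add_assoc]
    exact h₂ (h₁ hC)

/-- The graph of `f` over `C` is cut out by finitely many inequalities in `V × W`. Adding `V × 0`
projects it along `V`, and the slice over `0 ∈ V` is the image. -/
theorem image [FiniteDimensional ℝ V] [FiniteDimensional ℝ W] {C : Set V}
    (hC : IsFiniteDualCone C) (f : V →ₗ[ℝ] W) : IsFiniteDualCone (f '' C) := by
  have h := (((hC.preimage (LinearMap.fst ℝ V W)).inter (zero.preimage
    (f ∘ₗ LinearMap.fst ℝ V W - LinearMap.snd ℝ V W))).add_submodule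
    (N := LinearMap.range (LinearMap.inl ℝ V W)) (Submodule.FG.of_finite)).preimage
    (LinearMap.inr ℝ V W)
  convert h using 1
  ext y
  simp only [Set.mem_image, Set.mem_preimage, Set.mem_add, Set.mem_inter_iff, SetLike.mem_coe,
    LinearMap.mem_range, LinearMap.fst_apply, LinearMap.sub_apply, LinearMap.comp_apply,
    LinearMap.snd_apply, Set.mem_singleton_iff, LinearMap.inr_apply, LinearMap.inl_apply]
  constructor
  · rintro ⟨x, hx, rfl⟩
    exact ⟨(x, f x), ⟨hx, sub_self _⟩, (-x, 0), ⟨-x, rfl⟩, by simp⟩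
  · rintro ⟨⟨x, z⟩, ⟨hx, hz⟩, _, ⟨u, rfl⟩, h⟩
    simp only [Prod.mk_add_mk, Prod.mk.injEq] at h hz
    refine ⟨x, hx, ?_⟩
    rw [← h.2, sub_eq_zero.1 hz, add_zero]

end IsFiniteDualCone

section PolyhedralCone

variable {n : ℕ}

theorem isPolyhedralCone_iff {C : Set (Euc n)} : IsPolyhedralCone C ↔ IsFiniteDualCone C := by
  classical
  constructor
  · rintro ⟨A, rfl⟩
    refine ⟨(fun a : Euc n => innerₗ (Euc n) a) '' A, A.finite_toSet.image _, ?_⟩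
    ext x
    simp
  · rintro ⟨A, hA, rfl⟩
    refine ⟨hA.toFinset.image fun a =>
      (InnerProductSpace.toDual ℝ (Euc n)).symm (LinearMap.toContinuousLinearMap a), ?_⟩
    ext x
    simp [InnerProductSpace.toDual_symm_apply]

namespace IsPolyhedralCone

variable {C : Set (Euc n)} (hC : IsPolyhedralCone C)
include hC

theorem isClosed : IsClosed C := by
  obtain ⟨A, rfl⟩ := hC
  simp only [Set.ofPred_forall]
  exact isClosed_iInter fun a => isClosed_iInter fun _ =>
    isClosed_le continuous_const (by fun_prop)

theorem zero_mem : (0 : Euc n) ∈ C := by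
  obtain ⟨A, rfl⟩ := hC
  simp

theorem add_mem {x y : Euc n} (hx : x ∈ C) (hy : y ∈ C) : x + y ∈ C := by
  obtain ⟨A, rfl⟩ := hC
  intro a ha
  rw [inner_add_right]
  exact add_nonneg (hx a ha) (hy a ha)

theorem smul_mem {x : Euc n} (hx : x ∈ C) {t : ℝ} (ht : 0 ≤ t) : t • x ∈ C := by
  obtain ⟨A, rfl⟩ := hC
  intro a ha
  rw [inner_smul_right]
  exact mul_nonneg ht (hx a ha)

theorem sum_mem {κ : Type*} (s : Finset κ) {f : κ → Euc n} (hf : ∀ k ∈ s, f k ∈ C) :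
    ∑ k ∈ s, f k ∈ C :=
  Finset.sum_induction f (· ∈ C) (fun _ _ => hC.add_mem) hC.zero_mem hf

theorem convex : Convex ℝ C := fun _ hx _ hy _ _ ha hb _ =>
  hC.add_mem (hC.smul_mem hx ha) (hC.smul_mem hy hb)

theorem add_mem_interior {x y : Euc n} (hx : x ∈ C) (hy : y ∈ interior C) :
    x + y ∈ interior C := by
  have h : (fun z => x + z) '' interior C ⊆ C := by
    rintro _ ⟨z, hz, rfl⟩
    exact hC.add_mem hx (interior_subset hz)
  exact interior_maximal h ((Homeomorph.addLeft x).isOpenMap _ isOpen_interior) ⟨y, hy, rfl⟩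

end IsPolyhedralCone

end PolyhedralCone

/-! ### Dimension and null sets -/

section Dimension

open MeasureTheory

variable {n : ℕ}

theorem volume_eq_zero_of_affDim_lt {C : Set (Euc n)} (hC : affDim C < n) : volume C = 0 := by
  refine measure_mono_null (subset_affineSpan ℝ C) (Measure.addHaar_affineSubspace _ _ fun h => ?_)
  have h1 : vectorSpan ℝ C = ⊤ := by
    rw [← direction_affineSpan, h, AffineSubspace.direction_top]
  rw [affDim, h1, finrank_top, finrank_euclideanSpace_fin] at hC
  exact lt_irrefl _ hC

theorem affDim_lt_of_interior_eq_empty {C : Set (Euc n)} (hC : Convex ℝ C) (hne : C.Nonempty)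
    (h : interior C = ∅) : affDim C < n := by
  by_contra hn
  have h1 : vectorSpan ℝ C = ⊤ := by
    refine Submodule.eq_top_of_finrank_eq (le_antisymm (Submodule.finrank_le _) ?_)
    rw [finrank_euclideanSpace_fin]
    exact not_lt.1 hn
  have h2 : affineSpan ℝ C = ⊤ := by
    rwa [AffineSubspace.affineSpan_eq_top_iff_vectorSpan_eq_top_of_nonempty _ _ _ hne]
  exact (hC.interior_nonempty_iff_affineSpan_eq_top.2 h2).ne_empty h

theorem vectorSpan_eq_top_of_interior_nonempty {C : Set (Euc n)} (h : (interior C).Nonempty) :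
    vectorSpan ℝ C = ⊤ := by
  have h1 : affineSpan ℝ C = ⊤ := by
    refine top_unique ?_
    rw [← isOpen_interior.affineSpan_eq_top h]
    exact affineSpan_mono ℝ interior_subset
  rw [← direction_affineSpan, h1, AffineSubspace.direction_top]

theorem vectorSpan_eq_span_of_zero_mem {C : Set (Euc n)} (h : (0 : Euc n) ∈ C) :
    vectorSpan ℝ C = Submodule.span ℝ C := by
  rw [vectorSpan_eq_span_vsub_set_right ℝ h]
  simp

/-- Lower-dimensional sets are Lebesgue null, and a null open set is empty. -/
theorem IsOpen.eq_empty_of_subset_iUnion_of_affDim_lt {κ : Type*} [Countable κ]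
    {C : κ → Set (Euc n)} (hC : ∀ k, affDim (C k) < n) {U : Set (Euc n)} (hU : IsOpen U)
    (h : U ⊆ ⋃ k, C k) : U = ∅ :=
  (hU.measure_eq_zero_iff volume).1 (measure_mono_null h
    (measure_iUnion_null fun k => volume_eq_zero_of_affDim_lt (hC k)))

end Dimension

/-! ### Quadratic forms and pseudoinverses -/

section Matrices

variable {n : ℕ}

theorem matAct_add (Q : Matrix (Fin n) (Fin n) ℝ) (x y : Euc n) :
    matAct Q (x + y) = matAct Q x + matAct Q y := map_add _ _ _

theorem matAct_smul (Q : Matrix (Fin n) (Fin n) ℝ) (t : ℝ) (x : Euc n) :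
    matAct Q (t • x) = t • matAct Q x := map_smul _ _ _

theorem matAct_zero (Q : Matrix (Fin n) (Fin n) ℝ) : matAct Q 0 = 0 := map_zero _

theorem matAct_sum {κ : Type*} (Q : Matrix (Fin n) (Fin n) ℝ) (s : Finset κ) (f : κ → Euc n) :
    matAct Q (∑ k ∈ s, f k) = ∑ k ∈ s, matAct Q (f k) := map_sum _ _ _

theorem matAct_mul (A B : Matrix (Fin n) (Fin n) ℝ) (x : Euc n) :
    matAct (A * B) x = matAct A (matAct B x) := by
  simp [matAct, Matrix.toLpLin_apply]

theorem matAct_one (x : Euc n) : matAct 1 x = x := by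
  simp [matAct]

theorem continuous_matAct (Q : Matrix (Fin n) (Fin n) ℝ) : Continuous (matAct Q) :=
  LinearMap.continuous_of_finiteDimensional (Matrix.toEuclideanLin Q)

theorem matAct_injective : Function.Injective (matAct (n := n)) := fun _ _ h =>
  Matrix.toEuclideanLin.injective (LinearMap.ext fun x => congrFun h x)

theorem inner_matAct_transpose (Q : Matrix (Fin n) (Fin n) ℝ) (x y : Euc n) :
    inner ℝ (matAct Qᵀ x) y = inner ℝ x (matAct Q y) := by
  rw [matAct, matAct, ← Matrix.conjTranspose_eq_transpose_of_trivial,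
    Matrix.toEuclideanLin_conjTranspose_eq_adjoint, LinearMap.adjoint_inner_left]

theorem inner_matAct_comm {Q : Matrix (Fin n) (Fin n) ℝ} (hQ : Q.IsHermitian) (x y : Euc n) :
    inner ℝ (matAct Q x) y = inner ℝ (matAct Q y) x := by
  rw [Matrix.IsHermitian, Matrix.conjTranspose_eq_transpose_of_trivial] at hQ
  conv_lhs => rw [← hQ]
  rw [inner_matAct_transpose, real_inner_comm]

theorem quadForm_eq_inner (Q : Matrix (Fin n) (Fin n) ℝ) (x : Euc n) :
    quadForm Q x = inner ℝ (matAct Q x) x := real_inner_comm _ _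

theorem quadForm_smul (Q : Matrix (Fin n) (Fin n) ℝ) (t : ℝ) (x : Euc n) :
    quadForm Q (t • x) = t ^ 2 * quadForm Q x := by
  rw [quadForm, matAct_smul, real_inner_smul_left, real_inner_smul_right, quadForm]
  ring

theorem quadForm_add {Q : Matrix (Fin n) (Fin n) ℝ} (hQ : Q.IsHermitian) (x y : Euc n) :
    quadForm Q (x + y) = quadForm Q x + 2 * inner ℝ (matAct Q x) y + quadForm Q y := by
  rw [quadForm_eq_inner, matAct_add, inner_add_left, inner_add_right, inner_add_right,
    inner_matAct_comm hQ y x, quadForm_eq_inner, quadForm_eq_inner]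
  ring

theorem quadForm_add_smul {Q : Matrix (Fin n) (Fin n) ℝ} (hQ : Q.IsHermitian) (x y : Euc n)
    (t : ℝ) : quadForm Q (x + t • y) =
      quadForm Q x + 2 * t * inner ℝ (matAct Q x) y + t ^ 2 * quadForm Q y := by
  rw [quadForm_add hQ, quadForm_smul, inner_smul_right]
  ring

theorem continuous_quadForm (Q : Matrix (Fin n) (Fin n) ℝ) : Continuous (quadForm Q) :=
  continuous_id.inner (continuous_matAct Q)

theorem posSemidef_iff_quadForm_nonneg {Q : Matrix (Fin n) (Fin n) ℝ} :
    Q.PosSemidef ↔ Q.IsHermitian ∧ ∀ x, 0 ≤ quadForm Q x := by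
  rw [Matrix.posSemidef_iff_dotProduct_mulVec]
  refine and_congr_right fun _ => ⟨fun h x => ?_, fun h x => ?_⟩
  · have := h x.ofLp
    simpa [quadForm, matAct, EuclideanSpace.inner_eq_star_dotProduct, dotProduct_comm,
      Matrix.toLpLin_apply] using this
  · have := h (WithLp.toLp 2 x)
    simpa [quadForm, matAct, EuclideanSpace.inner_eq_star_dotProduct, dotProduct_comm,
      Matrix.toLpLin_apply] using this

theorem Matrix.PosSemidef.quadForm_nonneg {Q : Matrix (Fin n) (Fin n) ℝ} (hQ : Q.PosSemidef)
    (x : Euc n) : 0 ≤ quadForm Q x := (posSemidef_iff_quadForm_nonneg.1 hQ).2 x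

theorem isHermitian_iff_transpose {Q : Matrix (Fin n) (Fin n) ℝ} : Q.IsHermitian ↔ Qᵀ = Q := by
  rw [Matrix.IsHermitian, Matrix.conjTranspose_eq_transpose_of_trivial]

/-- Transposing the Penrose equations of a symmetric matrix permutes them, so uniqueness applies. -/
theorem isHermitian_pinv {A : Matrix (Fin n) (Fin n) ℝ} (hA : A.IsHermitian) :
    (pinv A).IsHermitian := by
  have h := pinv_spec hA
  have hT := isHermitian_iff_transpose.1 hA
  rw [isHermitian_iff_transpose]
  refine IsMoorePenroseInverse.unique (A := A) ⟨?_, ?_, ?_, ?_⟩ h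
  · have := congrArg Matrix.transpose h.mul_mul_left
    simpa [Matrix.transpose_mul, hT, mul_assoc] using this
  · have := congrArg Matrix.transpose h.mul_mul_right
    simpa [Matrix.transpose_mul, hT, mul_assoc] using this
  · have := h.symm_right
    rw [Matrix.transpose_mul, hT] at this
    rw [this, ← this, Matrix.transpose_mul, hT, Matrix.transpose_transpose, this]
  · have := h.symm_left
    rw [Matrix.transpose_mul, hT] at this
    rw [this, ← this, Matrix.transpose_mul, hT, Matrix.transpose_transpose, this]

theorem quadForm_pinv_matAct {A : Matrix (Fin n) (Fin n) ℝ} (hA : A.IsHermitian) (x : Euc n) :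
    quadForm (pinv A) (matAct A x) = quadForm A x := by
  rw [quadForm_eq_inner, real_inner_comm, inner_matAct_comm hA, ← matAct_mul, ← matAct_mul,
    (pinv_spec hA).mul_mul_left, quadForm_eq_inner]

theorem quadForm_transpose_mul_mul (E A : Matrix (Fin n) (Fin n) ℝ) (x : Euc n) :
    quadForm (Eᵀ * A * E) x = quadForm A (matAct E x) := by
  rw [quadForm_eq_inner, matAct_mul, matAct_mul, inner_matAct_transpose, quadForm_eq_inner]

theorem Matrix.IsHermitian.conj_transpose_self {A : Matrix (Fin n) (Fin n) ℝ}
    (hA : A.IsHermitian) (E : Matrix (Fin n) (Fin n) ℝ) : (E * A * Eᵀ).IsHermitian := by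
  rw [isHermitian_iff_transpose] at hA ⊢
  rw [Matrix.transpose_mul, Matrix.transpose_mul, Matrix.transpose_transpose, hA, mul_assoc]

theorem posSemidef_pinv {A : Matrix (Fin n) (Fin n) ℝ} (hA : A.PosSemidef) :
    (pinv A).PosSemidef := by
  have hH := hA.isHermitian
  refine posSemidef_iff_quadForm_nonneg.2 ⟨isHermitian_pinv hH, fun x => ?_⟩
  have h : quadForm (pinv A) x = quadForm A (matAct (pinv A) x) := by
    conv_lhs => rw [← (pinv_spec hH).mul_mul_right]
    have hT := isHermitian_iff_transpose.1 (isHermitian_pinv hH)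
    have h := quadForm_transpose_mul_mul (pinv A) A x
    rwa [hT] at h
  rw [h]
  exact hA.quadForm_nonneg _

end Matrices

/-! ### The matrices `E_I` and `M_I` -/

section Projection

variable {n : ℕ} {ι : Type} (P : ι → Set (Euc n)) (Q : ι → Matrix (Fin n) (Fin n) ℝ)

theorem matAct_projMatrix (I : Set ι) (x : Euc n) :
    matAct (projMatrix P I) x = (vectorSpan ℝ (interCone P I)).starProjection x := by
  simp [matAct, projMatrix]

theorem inner_matAct_projMatrix (I : Set ι) (x y : Euc n) :
    inner ℝ (matAct (projMatrix P I) x) y = inner ℝ x (matAct (projMatrix P I) y) := by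
  rw [matAct_projMatrix, matAct_projMatrix, Submodule.inner_starProjection_left_eq_right]

theorem transpose_projMatrix (I : Set ι) : (projMatrix P I)ᵀ = projMatrix P I := by
  refine matAct_injective (funext fun x => ext_inner_right ℝ fun y => ?_)
  rw [inner_matAct_transpose, inner_matAct_projMatrix]

theorem matAct_projMatrix_mem_span {I : Set ι} (h0 : (0 : Euc n) ∈ interCone P I) (x : Euc n) :
    matAct (projMatrix P I) x ∈ Submodule.span ℝ (interCone P I) := by
  rw [matAct_projMatrix, ← vectorSpan_eq_span_of_zero_mem h0]
  exact Submodule.starProjection_apply_mem _ _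

theorem matAct_projMatrix_of_mem {I : Set ι} (h0 : (0 : Euc n) ∈ interCone P I) {x : Euc n}
    (hx : x ∈ interCone P I) : matAct (projMatrix P I) x = x := by
  rw [matAct_projMatrix, Submodule.starProjection_eq_self_iff,
    vectorSpan_eq_span_of_zero_mem h0]
  exact Submodule.subset_span hx

theorem matAct_projMatrix_congr {I : Set ι} (h0 : (0 : Euc n) ∈ interCone P I) {y z : Euc n}
    (h : ∀ w ∈ interCone P I, inner ℝ y w = inner ℝ z w) :
    matAct (projMatrix P I) y = matAct (projMatrix P I) z := by
  have hspan : ∀ w ∈ Submodule.span ℝ (interCone P I), inner ℝ y w = inner ℝ z w := by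
    intro w hw
    induction hw using Submodule.span_induction with
    | mem w hw => exact h w hw
    | zero => simp
    | add u v _ _ hu hv => rw [inner_add_right, inner_add_right, hu, hv]
    | smul t u _ hu => rw [inner_smul_right, inner_smul_right, hu]
  refine ext_inner_right ℝ fun w => ?_
  rw [inner_matAct_projMatrix, inner_matAct_projMatrix]
  exact hspan _ (matAct_projMatrix_mem_span P h0 w)

/-- The matrix `M_I` evaluates on `y` to `xᵀ Q x` if `y` and `Q x` have the same projection. -/
theorem quadForm_polarMatrix {I : Set ι} (h0 : (0 : Euc n) ∈ interCone P I) {i : ι}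
    (hQ : (Q i).IsHermitian) {x y : Euc n} (hx : x ∈ interCone P I)
    (h : ∀ w ∈ interCone P I, inner ℝ y w = inner ℝ (matAct (Q i) x) w) :
    quadForm (polarMatrix P Q I i) y = quadForm (Q i) x := by
  have hE : matAct (projMatrix P I) y = matAct (projMatrix P I * Q i * (projMatrix P I)ᵀ) x := by
    rw [matAct_mul, matAct_mul, transpose_projMatrix, matAct_projMatrix_of_mem P h0 hx]
    exact matAct_projMatrix_congr P h0 h
  rw [polarMatrix, quadForm_transpose_mul_mul, hE,
    quadForm_pinv_matAct (hQ.conj_transpose_self _), quadForm_eq_inner, matAct_mul, matAct_mul,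
    transpose_projMatrix, matAct_projMatrix_of_mem P h0 hx, inner_matAct_projMatrix,
    matAct_projMatrix_of_mem P h0 hx, quadForm_eq_inner]

theorem posSemidef_polarMatrix (I : Set ι) {i : ι} (hQ : (Q i).PosSemidef) :
    (polarMatrix P Q I i).PosSemidef := by
  have h1 : (projMatrix P I * Q i * (projMatrix P I)ᵀ).PosSemidef := by
    refine posSemidef_iff_quadForm_nonneg.2 ⟨hQ.isHermitian.conj_transpose_self _, fun x => ?_⟩
    have h := quadForm_transpose_mul_mul ((projMatrix P I)ᵀ) (Q i) x
    rw [Matrix.transpose_transpose] at h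
    rw [h]
    exact hQ.quadForm_nonneg _
  have h2 := posSemidef_pinv h1
  refine posSemidef_iff_quadForm_nonneg.2 ⟨?_, fun x => ?_⟩
  · have h := h2.isHermitian.conj_transpose_self (projMatrix P I)ᵀ
    rwa [Matrix.transpose_transpose] at h
  · rw [polarMatrix, quadForm_transpose_mul_mul]
    exact h2.quadForm_nonneg _

theorem polarMatrix_singleton {i : ι} (hQ : (interior (P i)).Nonempty) :
    polarMatrix P Q {i} i = pinv (Q i) := by
  have h : projMatrix P {i} = 1 := by
    refine matAct_injective (funext fun x => ?_)
    have h1 : interCone P {i} = P i := by simp [interCone]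
    rw [matAct_projMatrix, matAct_one, h1, Submodule.starProjection_eq_self_iff,
      vectorSpan_eq_top_of_interior_nonempty hQ]
    trivial
  simp [polarMatrix, h]

end Projection

/-! ### The cones `K_I` -/

section PolarCone

open scoped Pointwise

variable {n : ℕ} {ι : Type} {P : ι → Set (Euc n)} {Q : ι → Matrix (Fin n) (Fin n) ℝ}

theorem isPolyhedralCone_interCone [Finite ι] (hP : ∀ i, IsPolyhedralCone (P i)) (I : Set ι) :
    IsPolyhedralCone (interCone P I) := by
  rw [isPolyhedralCone_iff, interCone, Set.biInter_eq_iInter]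
  exact IsFiniteDualCone.iInter fun i => isPolyhedralCone_iff.1 (hP i)

theorem isPolyhedralCone_image {C : Set (Euc n)} (hC : IsPolyhedralCone C)
    (A : Matrix (Fin n) (Fin n) ℝ) : IsPolyhedralCone (matAct A '' C) :=
  isPolyhedralCone_iff.2 ((isPolyhedralCone_iff.1 hC).image (Matrix.toEuclideanLin A))

theorem polarCone_singleton (hP : ∀ i, IsPolyhedralCone (P i)) (i : ι) :
    polarCone P Q {i} = matAct (Q i) '' P i := by
  have h := (isPolyhedralCone_image (hP i) (Q i)).convex
  simp only [polarCone, interCone, Set.mem_singleton_iff, Set.iUnion_iUnion_eq_left,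
    Set.iInter_iInter_eq_left]
  exact h.convexHull_eq

/-- The vector `y` is a sum of vectors `Q_i f_i` with `i ∈ I` and `f_i ∈ ⋂_{j ∈ I} P_j`, and `x` is
the sum of the vectors `f_i`. -/
def IsSumPair [Fintype ι] (P : ι → Set (Euc n)) (Q : ι → Matrix (Fin n) (Fin n) ℝ) (I : Set ι)
    (x y : Euc n) : Prop :=
  ∃ f : ι → Euc n, (∀ i ∈ I, f i ∈ interCone P I) ∧ (∀ i ∉ I, f i = 0) ∧
    x = ∑ i, f i ∧ y = ∑ i, matAct (Q i) (f i)

namespace IsSumPair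

variable [Fintype ι] {I : Set ι} {x y x' y' : Euc n}

theorem add (hP : ∀ i, IsPolyhedralCone (P i)) (h : IsSumPair P Q I x y)
    (h' : IsSumPair P Q I x' y') : IsSumPair P Q I (x + x') (y + y') := by
  obtain ⟨f, hf, hf0, rfl, rfl⟩ := h
  obtain ⟨g, hg, hg0, rfl, rfl⟩ := h'
  refine ⟨f + g, fun i hi => ?_, fun i hi => ?_, ?_, ?_⟩
  · exact (isPolyhedralCone_interCone hP I).add_mem (hf i hi) (hg i hi)
  · simp [hf0 i hi, hg0 i hi]
  · simp [Finset.sum_add_distrib]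
  · simp [Finset.sum_add_distrib, matAct_add]

theorem smul (hP : ∀ i, IsPolyhedralCone (P i)) (h : IsSumPair P Q I x y) {t : ℝ} (ht : 0 ≤ t) :
    IsSumPair P Q I (t • x) (t • y) := by
  obtain ⟨f, hf, hf0, rfl, rfl⟩ := h
  refine ⟨t • f, fun i hi => ?_, fun i hi => ?_, ?_, ?_⟩
  · exact (isPolyhedralCone_interCone hP I).smul_mem (hf i hi) ht
  · simp [hf0 i hi]
  · simp [Finset.smul_sum]
  · simp [Finset.smul_sum, matAct_smul]

theorem of_mem (hP : ∀ i, IsPolyhedralCone (P i)) {i : ι} (hi : i ∈ I)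
    (hx : x ∈ interCone P I) : IsSumPair P Q I x (matAct (Q i) x) := by
  classical
  refine ⟨Pi.single i x, fun j _ => ?_, fun j hj => ?_, ?_, ?_⟩
  · rcases eq_or_ne j i with rfl | h
    · simpa using hx
    · rw [Pi.single_eq_of_ne h]
      exact (isPolyhedralCone_interCone hP I).zero_mem
  · exact Pi.single_eq_of_ne (by rintro rfl; exact hj hi) _
  · simp
  · rw [Finset.sum_eq_single i]
    · simp
    · intro j _ h
      rw [Pi.single_eq_of_ne h, matAct_zero]
    · simp

theorem fst_mem (hP : ∀ i, IsPolyhedralCone (P i)) (h : IsSumPair P Q I x y) :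
    x ∈ interCone P I := by
  obtain ⟨f, hf, hf0, rfl, rfl⟩ := h
  refine (isPolyhedralCone_interCone hP I).sum_mem _ fun i _ => ?_
  by_cases hi : i ∈ I
  · exact hf i hi
  · rw [hf0 i hi]
    exact (isPolyhedralCone_interCone hP I).zero_mem

end IsSumPair

variable [Fintype ι] {I : Set ι}

theorem smul_mem_polarCone (hP : ∀ i, IsPolyhedralCone (P i)) {y : Euc n} {t : ℝ} (ht : 0 ≤ t)
    (hy : y ∈ polarCone P Q I) : t • y ∈ polarCone P Q I := by
  have h : t • y ∈ t • polarCone P Q I := Set.smul_mem_smul_set hy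
  rw [polarCone, ← convexHull_smul] at h
  refine convexHull_mono ?_ h
  rintro _ ⟨z, hz, rfl⟩
  obtain ⟨i, hi, x, hx, rfl⟩ := Set.mem_iUnion₂.1 hz
  exact Set.mem_iUnion₂.2 ⟨i, hi, t • x,
    (isPolyhedralCone_interCone hP I).smul_mem hx ht, matAct_smul _ _ _⟩

theorem add_mem_polarCone (hP : ∀ i, IsPolyhedralCone (P i)) {y z : Euc n}
    (hy : y ∈ polarCone P Q I) (hz : z ∈ polarCone P Q I) : y + z ∈ polarCone P Q I := by
  have h := (convex_convexHull ℝ _) hy hz (by norm_num : (0 : ℝ) ≤ 1 / 2)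
    (by norm_num : (0 : ℝ) ≤ 1 / 2) (by norm_num)
  have h2 := smul_mem_polarCone hP (by norm_num : (0 : ℝ) ≤ 2) h
  rw [smul_add, smul_smul, smul_smul] at h2
  norm_num at h2
  exact h2

/-- Since `C_I` is a convex cone, the weights of a convex combination can be absorbed into the
points. The sum `x` is recorded because it is the point at which `y` will be a subgradient. -/
theorem mem_polarCone_iff (hP : ∀ i, IsPolyhedralCone (P i)) (hI : I.Nonempty) {y : Euc n} :
    y ∈ polarCone P Q I ↔ ∃ x, IsSumPair P Q I x y := by
  constructor
  · intro hy
    refine convexHull_min (t := {y | ∃ x, IsSumPair P Q I x y}) ?_ ?_ hy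
    · intro z hz
      obtain ⟨i, hi, x, hx, rfl⟩ := Set.mem_iUnion₂.1 hz
      exact ⟨x, IsSumPair.of_mem hP hi hx⟩
    · rintro y ⟨x, h⟩ y' ⟨x', h'⟩ a b ha hb _
      exact ⟨_, (h.smul hP ha).add hP (h'.smul hP hb)⟩
  · rintro ⟨_, f, hf, hf0, rfl, rfl⟩
    have hmem : ∀ i ∈ I, ∀ x ∈ interCone P I, matAct (Q i) x ∈ polarCone P Q I :=
      fun i hi x hx => subset_convexHull ℝ _ (Set.mem_iUnion₂.2 ⟨i, hi, x, hx, rfl⟩)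
    have hzero : (0 : Euc n) ∈ polarCone P Q I := by
      obtain ⟨i, hi⟩ := hI
      simpa [matAct_zero] using hmem i hi 0 (isPolyhedralCone_interCone hP I).zero_mem
    refine Finset.sum_induction _ (· ∈ polarCone P Q I)
      (fun _ _ => add_mem_polarCone hP) hzero fun i _ => ?_
    by_cases hi : i ∈ I
    · exact hmem i hi _ (hf i hi)
    · simpa [hf0 i hi, matAct_zero] using hzero

/-- The cone is the image, under `f ↦ ∑ Q_i f_i`, of a product with factor `C_I` for `i ∈ I` and
`{0}` otherwise. -/
theorem isPolyhedralCone_polarCone (hP : ∀ i, IsPolyhedralCone (P i)) (hI : I.Nonempty) :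
    IsPolyhedralCone (polarCone P Q I) := by
  classical
  have hC := isPolyhedralCone_iff.1 (isPolyhedralCone_interCone hP I)
  have hD : IsFiniteDualCone
      (⋂ i, (LinearMap.proj i : (ι → Euc n) →ₗ[ℝ] Euc n) ⁻¹'
        (if i ∈ I then interCone P I else {0})) :=
    IsFiniteDualCone.iInter fun i => by
      split_ifs
      · exact hC.preimage _
      · exact IsFiniteDualCone.zero.preimage _
  have h := hD.image (∑ i, Matrix.toEuclideanLin (Q i) ∘ₗ LinearMap.proj i)
  rw [isPolyhedralCone_iff]
  convert h using 1
  ext y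
  rw [mem_polarCone_iff hP hI]
  constructor
  · rintro ⟨_, f, hf, hf0, -, rfl⟩
    refine ⟨f, Set.mem_iInter.2 fun i => ?_, ?_⟩
    · by_cases hi : i ∈ I
      · simpa [hi] using hf i hi
      · simpa [hi] using hf0 i hi
    · simp [matAct]
  · rintro ⟨f, hf, rfl⟩
    refine ⟨_, f, fun i hi => ?_, fun i hi => ?_, rfl, ?_⟩
    · simpa [hi] using Set.mem_iInter.1 hf i
    · simpa [hi] using Set.mem_iInter.1 hf i
    · simp [matAct]

end PolarCone

/-! ### Gauges, polars and subgradients -/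

section Minkowski

variable {n : ℕ} {S : Set (Euc n)} {x y z : Euc n}

theorem minkowski_le {γ : ℝ≥0} {s : Euc n} (hs : s ∈ S) : minkowski S ((γ : ℝ) • s) ≤ γ :=
  iInf₂_le γ ⟨s, hs, rfl⟩

theorem exists_of_minkowski_lt_top (h : minkowski S x < ∞) :
    ∃ γ : ℝ≥0, ∃ s ∈ S, x = (γ : ℝ) • s := by
  obtain ⟨γ, h1⟩ := iInf_lt_iff.1 h
  obtain ⟨h2, -⟩ := iInf_lt_iff.1 h1
  exact ⟨γ, h2⟩

theorem minkowski_add_le (hS : Convex ℝ S) (x y : Euc n) :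
    minkowski S (x + y) ≤ minkowski S x + minkowski S y := by
  simp only [minkowski, ENNReal.iInf_add, ENNReal.add_iInf]
  refine le_iInf fun γ => le_iInf ?_
  rintro ⟨s, hs, rfl⟩
  refine le_iInf fun δ => le_iInf ?_
  rintro ⟨t, ht, rfl⟩
  rcases eq_or_ne (γ + δ) 0 with h0 | h0
  · obtain ⟨rfl, rfl⟩ := add_eq_zero.1 h0
    exact iInf₂_le_of_le 0 ⟨s, hs, by simp⟩ (by simp)
  · have h1 : (0 : ℝ) < γ + δ := by exact_mod_cast pos_iff_ne_zero.2 h0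
    refine iInf₂_le_of_le (γ + δ) ⟨_, hS hs ht (a := γ / (γ + δ)) (b := δ / (γ + δ))
      (by positivity) (by positivity) (by field_simp), ?_⟩ (by simp [add_comm])
    rw [NNReal.coe_add, smul_add, smul_smul, smul_smul, mul_div_cancel₀ _ h1.ne',
      mul_div_cancel₀ _ h1.ne', add_comm]

theorem inner_le_minkowski (hy : y ∈ polarSet S) (x : Euc n) :
    ENNReal.ofReal (inner ℝ y x) ≤ minkowski S x := by
  refine le_iInf₂ ?_
  rintro γ ⟨s, hs, rfl⟩
  rw [inner_smul_right, ← ENNReal.ofReal_coe_nnreal]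
  exact ENNReal.ofReal_le_ofReal (mul_le_of_le_one_right γ.2 (hy s hs))

theorem zero_mem_polarSet : (0 : Euc n) ∈ polarSet S := fun x _ => by simp

theorem convex_polarSet : Convex ℝ (polarSet S) := by
  intro y hy z hz a b ha hb hab x hx
  rw [inner_add_left, real_inner_smul_left, real_inner_smul_left]
  nlinarith [mul_le_mul_of_nonneg_left (hy x hx) ha, mul_le_mul_of_nonneg_left (hz x hx) hb]

theorem isClosed_polarSet : IsClosed (polarSet S) := by
  simp only [polarSet, Set.ofPred_forall]
  exact isClosed_iInter fun x => isClosed_iInter fun _ =>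
    isClosed_le (by fun_prop) continuous_const

/-- The Minkowski function as a real number. -/
noncomputable def realGauge (S : Set (Euc n)) (x : Euc n) : ℝ := (minkowski S x).toReal

theorem realGauge_nonneg (S : Set (Euc n)) (x : Euc n) : 0 ≤ realGauge S x :=
  ENNReal.toReal_nonneg

theorem realGauge_le_one (hz : z ∈ S) : realGauge S z ≤ 1 := by
  have h := minkowski_le (γ := 1) hz
  rw [NNReal.coe_one, one_smul] at h
  exact ENNReal.toReal_mono (by simp) h

theorem inner_le_realGauge (hfin : ∀ x, minkowski S x ≠ ∞) (hy : y ∈ polarSet S) (x : Euc n) :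
    inner ℝ y x ≤ realGauge S x :=
  (ENNReal.ofReal_le_iff_le_toReal (hfin x)).1 (inner_le_minkowski hy x)

theorem realGauge_add_le (hS : Convex ℝ S) (hfin : ∀ x, minkowski S x ≠ ∞) (x y : Euc n) :
    realGauge S (x + y) ≤ realGauge S x + realGauge S y := by
  rw [realGauge, realGauge, realGauge, ← ENNReal.toReal_add (hfin x) (hfin y)]
  exact ENNReal.toReal_mono (ENNReal.add_ne_top.2 ⟨hfin x, hfin y⟩) (minkowski_add_le hS x y)

/-- The vector `y` is a subgradient at `x` of half the squared Minkowski function of `S`. -/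
structure IsGaugeSubgradient (S : Set (Euc n)) (x y : Euc n) : Prop where
  inner_le : ∀ z, inner ℝ y z ≤ realGauge S x * realGauge S z
  inner_eq : inner ℝ y x = realGauge S x ^ 2

/-- For `≤`, the vector `y` divided by the gauge of `x` lies in the polar; if that gauge is zero,
then `⟪y, y⟫ ≤ 0` forces `y = 0`. For `≥`, any representation of `y` as a multiple of a polar vector
is tested at `x`. -/
theorem IsGaugeSubgradient.minkowski_polarSet (h : IsGaugeSubgradient S x y)
    (hfin : ∀ x, minkowski S x ≠ ∞) :
    minkowski (polarSet S) y = ENNReal.ofReal (realGauge S x) := by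
  have h0 := realGauge_nonneg S x
  apply le_antisymm
  · rcases h0.eq_or_lt with h1 | h1
    · have h2 := h.inner_le y
      rw [← h1, zero_mul, real_inner_self_nonpos] at h2
      subst h2
      have h3 := minkowski_le (γ := 0) (zero_mem_polarSet (S := S))
      exact (by simpa using h3 : minkowski (polarSet S) 0 = 0).le.trans zero_le
    · have h2 : (realGauge S x)⁻¹ • y ∈ polarSet S := fun z hz => by
        rw [real_inner_smul_left, inv_mul_le_iff₀ h1]
        exact (h.inner_le z).trans (mul_le_mul_of_nonneg_left (realGauge_le_one hz) h0)
      have h3 := minkowski_le (γ := (realGauge S x).toNNReal) h2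
      rwa [Real.coe_toNNReal _ h0, smul_inv_smul₀ h1.ne'] at h3
  · refine le_iInf₂ ?_
    rintro γ ⟨s, hs, rfl⟩
    have h1 := h.inner_eq
    rw [real_inner_smul_left] at h1
    have h2 := mul_le_mul_of_nonneg_left (inner_le_realGauge hfin hs x) γ.2
    rw [← ENNReal.ofReal_coe_nnreal]
    refine ENNReal.ofReal_le_ofReal ?_
    rcases h0.eq_or_lt with h3 | h3
    · rw [← h3]
      exact γ.2
    · refine le_of_mul_le_mul_right ?_ h3
      rw [← sq, ← h1]
      exact h2

end Minkowski

/-- A linear inequality `a + ε b ≤ c + ε d` that holds for small `ε > 0` holds at `ε = 0`. -/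
theorem le_of_forall_small_pos {a b c d ε₀ : ℝ} (hε₀ : 0 < ε₀)
    (h : ∀ ε, 0 < ε → ε < ε₀ → a + ε * b ≤ c + ε * d) : a ≤ c := by
  have h1 : ∀ e : ℝ, Filter.Tendsto (fun ε : ℝ => e + ε * b) (nhdsWithin 0 (Set.Ioi 0))
    (nhds (e + 0 * b)) := fun e => ((by fun_prop :
      Continuous fun ε : ℝ => e + ε * b).tendsto 0).mono_left nhdsWithin_le_nhds
  have h2 : Filter.Tendsto (fun ε : ℝ => c + ε * d) (nhdsWithin 0 (Set.Ioi 0))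
    (nhds (c + 0 * d)) := ((by fun_prop :
      Continuous fun ε : ℝ => c + ε * d).tendsto 0).mono_left nhdsWithin_le_nhds
  have h3 := le_of_tendsto_of_tendsto (h1 a) h2 (by
    filter_upwards [Ioo_mem_nhdsGT hε₀] with ε hε using h ε hε.1 hε.2)
  simpa using h3

/-! ### Local structure of conic partitions -/

namespace IsConicPartition

variable {n : ℕ} {ι : Type} {P : ι → Set (Euc n)} (hP : IsConicPartition P)
include hP

theorem exists_mem (x : Euc n) : ∃ i, x ∈ P i := by
  have h : x ∈ ⋃ i, P i := hP.cover ▸ Set.mem_univ x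
  simpa using h

theorem eventually_mem_imp (x : Euc n) : ∀ᶠ z in nhds x, ∀ i, z ∈ P i → x ∈ P i := by
  have := hP.finite
  refine Filter.eventually_all.2 fun i => ?_
  by_cases hx : x ∈ P i
  · exact Filter.Eventually.of_forall fun _ _ => hx
  · filter_upwards [(hP.polyhedral i).isClosed.isOpen_compl.mem_nhds hx] with z hz h
    exact absurd h hz

/-- Every ray from `x` starts in a cone that contains `x`. -/
theorem exists_add_smul_mem (x d : Euc n) :
    ∃ i, x ∈ P i ∧ ∃ t : ℝ, 0 < t ∧ x + t • d ∈ P i := by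
  have h : Filter.Tendsto (fun t : ℝ => x + t • d) (nhdsWithin 0 (Set.Ioi 0)) (nhds x) := by
    have h1 : Continuous fun t : ℝ => x + t • d := by fun_prop
    have h2 := h1.tendsto 0
    rw [zero_smul, add_zero] at h2
    exact h2.mono_left nhdsWithin_le_nhds
  obtain ⟨t, h1, ht⟩ := ((h.eventually (hP.eventually_mem_imp x)).and
    self_mem_nhdsWithin).exists
  obtain ⟨i, hi⟩ := hP.exists_mem (x + t • d)
  exact ⟨i, h1 i hi, t, ht, hi⟩

theorem add_smul_mem {x d : Euc n} {i : ι} {t s : ℝ} (hx : x ∈ P i) (ht : 0 < t)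
    (h : x + t • d ∈ P i) (hs : 0 ≤ s) (hst : s ≤ t) : x + s • d ∈ P i := by
  have h1 := (hP.polyhedral i).convex hx h (a := 1 - s / t) (b := s / t)
    (sub_nonneg.2 ((div_le_one ht).2 hst)) (by positivity) (by ring)
  rwa [smul_add, smul_smul, div_mul_cancel₀ _ ht.ne', ← add_assoc, ← add_smul,
    sub_add_cancel, one_smul] at h1

theorem eq_empty_of_isOpen_of_subset_iUnion {U : Set (Euc n)} (hU : IsOpen U) (j : ι)
    (h : ∀ x ∈ U, x ∈ P j ∧ ∃ i, i ≠ j ∧ x ∈ P i) : U = ∅ := by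
  have := hP.finite
  refine hU.eq_empty_of_subset_iUnion_of_affDim_lt (κ := {i // i ≠ j})
    (C := fun i => P i ∩ P j) (fun i => hP.dim_inter_lt _ _ i.2) fun x hx => ?_
  obtain ⟨h1, i, h2, h3⟩ := h x hx
  exact Set.mem_iUnion.2 ⟨⟨i, h2⟩, h3, h1⟩

/-- Otherwise every interior point of `P j` would lie in a second cone, but the intersections of `P
j` with the others are null. -/
theorem isActive_singleton (j : ι) : IsActive P {j} := by
  by_contra hn
  refine (hP.interior_nonempty j).ne_empty
    (hP.eq_empty_of_isOpen_of_subset_iUnion isOpen_interior j fun x hx => ?_)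
  have hxj := interior_subset hx
  refine ⟨hxj, ?_⟩
  by_contra! h
  refine hn ⟨x, Set.ext fun i => ⟨?_, fun hi => ?_⟩⟩
  · rintro rfl
    exact hxj
  · by_contra hij
    exact h i hij hi

/-- Adding a witness of an active set `I` to a point of `⋂_{i ∈ I} P_i` gives a witness. -/
theorem setOf_mem_add_smul {x₁ x' : Euc n} (hx' : x' ∈ interCone P {i | x₁ ∈ P i}) {t : ℝ}
    (ht : 0 < t) : {j | x' + t • x₁ ∈ P j} = {j | x₁ ∈ P j} := by
  have hmem : ∀ i, x₁ ∈ P i → x' ∈ P i := fun i hi => Set.mem_iInter₂.1 hx' i hi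
  ext j
  refine ⟨fun hj => ?_, fun hj => (hP.polyhedral j).add_mem (hmem j hj)
    ((hP.polyhedral j).smul_mem hj ht.le)⟩
  by_contra hnj
  obtain ⟨r, hr, hball⟩ := Metric.eventually_nhds_iff_ball.1 (hP.eventually_mem_imp (t • x₁))
  obtain ⟨p, hp⟩ := hP.interior_nonempty j
  have hscale : ∀ i, t • x₁ ∈ P i → x₁ ∈ P i := fun i hi => by
    have h := (hP.polyhedral i).smul_mem hi (inv_nonneg.2 ht.le)
    rwa [inv_smul_smul₀ ht.ne'] at h
  -- If `j` were active at `x' + t • x₁` but not at `x₁`, a small step `u` into `P j` would stay in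
  -- `P j`. It would also lie in some `P i` active at `x₁`, since `t • x₁ + u` and `x'` both belong
  -- to such a `P i`. An open part of `P j` would thus be covered by other cones.
  have hsub : ∀ u ∈ Metric.ball (0 : Euc n) r, u ∈ P j →
      x' + t • x₁ + u ∈ P j ∧ ∃ i, i ≠ j ∧ x' + t • x₁ + u ∈ P i := by
    intro u hu huj
    refine ⟨(hP.polyhedral j).add_mem hj huj, ?_⟩
    obtain ⟨i, hi⟩ := hP.exists_mem (t • x₁ + u)
    have hi1 : x₁ ∈ P i := hscale i (hball _ (by simpa using hu) i hi)
    refine ⟨i, ?_, ?_⟩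
    · rintro rfl
      exact hnj hi1
    · rw [add_assoc]
      exact (hP.polyhedral i).add_mem (hmem i hi1) hi
  have hU : IsOpen ((fun u => x' + t • x₁ + u) '' (Metric.ball 0 r ∩ interior (P j))) :=
    (Homeomorph.addLeft (x' + t • x₁)).isOpenMap _ (Metric.isOpen_ball.inter isOpen_interior)
  have h0 := hP.eq_empty_of_isOpen_of_subset_iUnion hU j (by
    rintro _ ⟨u, ⟨hu, huj⟩, rfl⟩
    exact hsub u hu (interior_subset huj))
  rw [Set.image_eq_empty] at h0
  obtain ⟨s, hs, hs0⟩ : ∃ s : ℝ, s • p ∈ Metric.ball (0 : Euc n) r ∧ 0 < s := by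
    have h1 : Continuous fun s : ℝ => s • p := by fun_prop
    have h2 := h1.tendsto 0
    rw [zero_smul] at h2
    exact (((h2.mono_left nhdsWithin_le_nhds).eventually (Metric.ball_mem_nhds 0 hr)).and
      (self_mem_nhdsWithin (s := Set.Ioi (0 : ℝ)))).exists
  have h3 : s • p ∈ interior (P j) := by
    have h4 : (fun z : Euc n => s • z) '' interior (P j) ⊆ P j := by
      rintro _ ⟨z, hz, rfl⟩
      exact (hP.polyhedral j).smul_mem (interior_subset hz) hs0.le
    exact interior_maximal h4 ((Homeomorph.smulOfNeZero s hs0.ne').isOpenMap _ isOpen_interior)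
      ⟨p, hp, rfl⟩
  exact h0.le ⟨hs, h3⟩

omit hP in
theorem _root_.IsActive.isCell {I : Set ι} (hI : IsActive P I) : IsCell P I := by
  obtain ⟨x, rfl⟩ := hI
  refine ⟨x, Set.mem_iInter₂.2 fun _ hi => hi, fun j hj => Set.biInter_subset_of_mem hj⟩

theorem _root_.IsActive.nonempty {I : Set ι} (hI : IsActive P I) : I.Nonempty := by
  obtain ⟨x, rfl⟩ := hI
  exact hP.exists_mem x

/-- In a face-to-face partition, every intersection of cones of the partition is a cell. -/
theorem isCell_of_isFaceToFace (hF : IsFaceToFace P) {I : Set ι} (hI : I.Nonempty) :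
    IsCell P I := by
  classical
  have := hP.finite
  have := Fintype.ofFinite ι
  obtain ⟨i, hi⟩ := hI
  have hC := isPolyhedralCone_interCone hP.polyhedral I
  have hsub : interCone P I ⊆ P i := Set.biInter_subset_of_mem hi
  have hex : ∀ j, ∃ x ∈ interCone P I, ¬ interCone P I ⊆ P j → x ∉ P j := by
    intro j
    by_cases h : interCone P I ⊆ P j
    · exact ⟨0, hC.zero_mem, fun h' => absurd h h'⟩
    · obtain ⟨x, hx, hxj⟩ := Set.not_subset.1 h
      exact ⟨x, hx, fun _ => hxj⟩
  choose p hp hpj using hex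
  -- Each `p j` avoids `P j` unless `C_I ⊆ P j`. If the sum lay in `P j`, so would its half, the
  -- midpoint of `p j` and the sum of the remaining points; the face property would then put `p j`
  -- in `P j`.
  refine ⟨∑ j, p j, hC.sum_mem _ fun j _ => hp j, fun j hj => ?_⟩
  by_contra hn
  refine hpj j hn ?_
  have hrest : ∑ k ∈ Finset.univ.erase j, p k ∈ interCone P I := hC.sum_mem _ fun k _ => hp k
  rw [← Finset.add_sum_erase _ _ (Finset.mem_univ j)] at hj
  set q := ∑ k ∈ Finset.univ.erase j, p k
  have hmid : (1 / 2 : ℝ) • (p j + q) ∈ P i ∩ P j :=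
    ⟨(hP.polyhedral i).smul_mem (hsub (hC.add_mem (hp j) hrest)) (by norm_num),
      (hP.polyhedral j).smul_mem hj (by norm_num)⟩
  exact ((hF i j).left_mem_of_mem_openSegment (hsub (hp j)) (hsub hrest) hmid
    ⟨1 / 2, 1 / 2, by norm_num, by norm_num, by norm_num, (smul_add _ _ _).symm⟩).2

end IsConicPartition

/-! ### Subgradients of the squared gauge and the formulas for the polar -/

namespace IsPiecewiseSemiEllipsoidOf

variable {n : ℕ} {ι : Type} {S : Set (Euc n)} {P : ι → Set (Euc n)}
  {Q : ι → Matrix (Fin n) (Fin n) ℝ} (hS : IsPiecewiseSemiEllipsoidOf S P Q)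
include hS

theorem minkowski_ne_top (x : Euc n) : minkowski S x ≠ ∞ := by
  obtain ⟨i, hi⟩ := hS.partition.exists_mem x
  rw [hS.minkowski_eq i x hi]
  exact ENNReal.ofReal_ne_top

theorem realGauge_eq {i : ι} {x : Euc n} (hx : x ∈ P i) :
    realGauge S x = √(quadForm (Q i) x) := by
  rw [realGauge, hS.minkowski_eq i x hx, ENNReal.toReal_ofReal (Real.sqrt_nonneg _)]

theorem realGauge_sq {i : ι} {x : Euc n} (hx : x ∈ P i) :
    realGauge S x ^ 2 = quadForm (Q i) x := by
  rw [hS.realGauge_eq hx, Real.sq_sqrt ((hS.posSemidef i).quadForm_nonneg x)]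

theorem realGauge_smul (x : Euc n) {t : ℝ} (ht : 0 ≤ t) :
    realGauge S (t • x) = t * realGauge S x := by
  obtain ⟨i, hi⟩ := hS.partition.exists_mem x
  rw [hS.realGauge_eq hi, hS.realGauge_eq ((hS.partition.polyhedral i).smul_mem hi ht),
    quadForm_smul, Real.sqrt_mul (sq_nonneg t), Real.sqrt_sq ht]

theorem realGauge_add_smul_le (x y : Euc n) {t : ℝ} (ht : 0 ≤ t) :
    realGauge S (x + t • y) ≤ realGauge S x + t * realGauge S y := by
  rw [← hS.realGauge_smul y ht]
  exact realGauge_add_le hS.convex hS.minkowski_ne_top _ _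

theorem continuous_realGauge : Continuous (realGauge S) := by
  have := hS.partition.finite
  refine (locallyFinite_of_finite P).continuous hS.partition.cover
    (fun i => (hS.partition.polyhedral i).isClosed) fun i => ?_
  exact (continuous_quadForm (Q i)).sqrt.continuousOn.congr fun x hx => hS.realGauge_eq hx

/-- Near `x` the squared gauge is the quadratic form of `Q i`. The first-order terms in `t` of γ(x +
tz)² ≤ (γ(x) + tγ(z))² give the inequality. -/
theorem inner_matAct_le_of_interior {i : ι} {x : Euc n} (hx : x ∈ interior (P i)) (z : Euc n) :
    inner ℝ (matAct (Q i) x) z ≤ realGauge S x * realGauge S z := by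
  have h1 : Continuous fun t : ℝ => x + t • z := by fun_prop
  have h2 := h1.tendsto 0
  rw [zero_smul, add_zero] at h2
  obtain ⟨r, hr, h3⟩ := Metric.eventually_nhds_iff.1
    (h2.eventually (mem_interior_iff_mem_nhds.1 hx))
  refine le_of_forall_small_pos (b := quadForm (Q i) z / 2) (d := realGauge S z ^ 2 / 2) hr
    fun t ht htr => ?_
  have h4 : x + t • z ∈ P i := h3 (by rwa [Real.dist_eq, sub_zero, abs_of_pos ht])
  have h5 := hS.realGauge_sq h4
  rw [quadForm_add_smul (hS.posSemidef i).isHermitian, ← hS.realGauge_sq (interior_subset hx)]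
    at h5
  have h6 := pow_le_pow_left₀ (realGauge_nonneg S _) (hS.realGauge_add_smul_le x z ht.le) 2
  rw [h5] at h6
  refine le_of_mul_le_mul_left ?_ (mul_pos two_pos ht)
  linarith

/-- The vector `Q_i x` is a subgradient at `x ∈ P_i`. -/
theorem isGaugeSubgradient_matAct {i : ι} {x : Euc n} (hx : x ∈ P i) :
    IsGaugeSubgradient S x (matAct (Q i) x) := by
  refine ⟨fun z => ?_, by rw [hS.realGauge_sq hx, quadForm_eq_inner]⟩
  obtain ⟨p, hp⟩ := hS.partition.interior_nonempty i
  have hC := hS.partition.polyhedral i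
  refine le_of_forall_small_pos (b := inner ℝ (matAct (Q i) p) z)
    (d := realGauge S p * realGauge S z) one_pos fun t ht _ => ?_
  -- A boundary point is approached along `x + t • p` from the interior, and the inequality passes
  -- to the limit.
  have h1 : x + t • p ∈ interior (P i) := by
    refine hC.add_mem_interior hx (interior_maximal (s := P i)
      (t := (fun z : Euc n => t • z) '' interior (P i)) ?_
      ((Homeomorph.smulOfNeZero t ht.ne').isOpenMap _ isOpen_interior) ⟨p, hp, rfl⟩)
    rintro _ ⟨z, hz, rfl⟩
    exact hC.smul_mem (interior_subset hz) ht.le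
  have h2 := hS.inner_matAct_le_of_interior h1 z
  rw [matAct_add, matAct_smul, inner_add_left, real_inner_smul_left] at h2
  have h3 := mul_le_mul_of_nonneg_right (hS.realGauge_add_smul_le x p ht.le)
    (realGauge_nonneg S z)
  linarith

/-- Every subgradient at `x` is a convex combination of the vectors `Q_i x` with `x ∈ P_i`. -/
theorem mem_convexHull_of_isGaugeSubgradient {x y : Euc n} (h : IsGaugeSubgradient S x y) :
    y ∈ convexHull ℝ ((fun i => matAct (Q i) x) '' {i | x ∈ P i}) := by
  have := hS.partition.finite
  by_contra hn
  have hK : IsCompact (convexHull ℝ ((fun i => matAct (Q i) x) '' {i | x ∈ P i})) :=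
    ((Set.toFinite _).image _).isCompact_convexHull ℝ
  obtain ⟨f, u, hfu, hu⟩ := geometric_hahn_banach_closed_point (convex_convexHull ℝ _)
    hK.isClosed hn
  set d := (InnerProductSpace.toDual ℝ (Euc n)).symm f with hd
  have hf : ∀ z, f z = inner ℝ z d := fun z => by
    rw [real_inner_comm, hd, InnerProductSpace.toDual_symm_apply]
  -- In a separating direction `d`, the ray from `x` starts in some `P i` containing `x`. There half
  -- the squared gauge has slope `⟪Q_i x, d⟫`, which is at least `⟪y, d⟫`, contrary to the
  -- separation.
  obtain ⟨i, hi, t₀, ht₀, hmem⟩ := hS.partition.exists_add_smul_mem x d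
  have h1 := hfu _ (subset_convexHull ℝ _ ⟨i, hi, rfl⟩)
  rw [hf] at h1 hu
  refine absurd (h1.trans hu) (not_lt.2 ?_)
  refine le_of_forall_small_pos (b := 0) (d := quadForm (Q i) d / 2) ht₀ fun t ht htt => ?_
  have h2 := hS.realGauge_sq (hS.partition.add_smul_mem hi ht₀ hmem ht.le htt.le)
  rw [quadForm_add_smul (hS.posSemidef i).isHermitian, ← hS.realGauge_sq hi] at h2
  have h3 := h.inner_le (x + t • d)
  rw [inner_add_right, inner_smul_right, h.inner_eq] at h3
  refine le_of_mul_le_mul_left ?_ ht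
  -- The product of the two gauges is at most half the sum of their squares.
  nlinarith [sq_nonneg (realGauge S x - realGauge S (x + t • d))]

/-- The matrices `Q_i` and `Q_j` define the same bilinear form on a convex cone in `P_i ∩ P_j`. -/
theorem inner_matAct_eq {i j : ι} {x w : Euc n} (hxi : x ∈ P i) (hxj : x ∈ P j)
    (hwi : w ∈ P i) (hwj : w ∈ P j) :
    inner ℝ (matAct (Q i) x) w = inner ℝ (matAct (Q j) x) w := by
  have hi := quadForm_add (hS.posSemidef i).isHermitian x w
  have hj := quadForm_add (hS.posSemidef j).isHermitian x w
  rw [← hS.realGauge_sq hxi, ← hS.realGauge_sq hwi,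
    ← hS.realGauge_sq ((hS.partition.polyhedral i).add_mem hxi hwi)] at hi
  rw [← hS.realGauge_sq hxj, ← hS.realGauge_sq hwj,
    ← hS.realGauge_sq ((hS.partition.polyhedral j).add_mem hxj hwj)] at hj
  linarith

theorem isPolyhedralCone_interCone (I : Set ι) : IsPolyhedralCone (interCone P I) :=
  have := hS.partition.finite
  _root_.isPolyhedralCone_interCone hS.partition.polyhedral I

/-- The bilinear forms agree on `C_I`, hence on its span, which is the range of the projection. -/
theorem projMatrix_mul_mul_eq {I : Set ι} {i j : ι} (hi : i ∈ I) (hj : j ∈ I) :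
    projMatrix P I * Q i * (projMatrix P I)ᵀ = projMatrix P I * Q j * (projMatrix P I)ᵀ := by
  have h0 := (hS.isPolyhedralCone_interCone I).zero_mem
  have hsub : ∀ k ∈ I, interCone P I ⊆ P k := fun k hk => Set.biInter_subset_of_mem hk
  refine matAct_injective (funext fun x => ?_)
  rw [matAct_mul, matAct_mul, matAct_mul, matAct_mul, transpose_projMatrix]
  have hx := matAct_projMatrix_mem_span P h0 x
  refine Submodule.span_induction (p := fun u _ => matAct (projMatrix P I) (matAct (Q i) u) =
    matAct (projMatrix P I) (matAct (Q j) u)) (fun u hu => ?_) ?_ ?_ ?_ hx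
  · exact matAct_projMatrix_congr P h0 fun w hw =>
      hS.inner_matAct_eq (hsub i hi hu) (hsub j hj hu) (hsub i hi hw) (hsub j hj hw)
  · simp [matAct_zero]
  · intro u v _ _ hu hv
    simp only [matAct_add, hu, hv]
  · intro t u _ hu
    simp only [matAct_smul, hu]

theorem minkowski_polarSet_eq {I : Set ι} {i : ι} (hi : i ∈ I) {x y : Euc n}
    (hx : x ∈ interCone P I) (hxy : IsGaugeSubgradient S x y)
    (h : ∀ w ∈ interCone P I, inner ℝ y w = inner ℝ (matAct (Q i) x) w) :
    minkowski (polarSet S) y = ENNReal.ofReal (√(quadForm (polarMatrix P Q I i) y)) := by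
  rw [hxy.minkowski_polarSet hS.minkowski_ne_top, quadForm_polarMatrix P Q
    (hS.isPolyhedralCone_interCone I).zero_mem (hS.posSemidef i).isHermitian hx h,
    hS.realGauge_eq (Set.mem_iInter₂.1 hx i hi)]

/-- Being a subgradient at the fixed `x`, and agreeing with `Q_i x` on `C_I`, are convex conditions
on `y`, so it suffices to check the generators `Q_j x`. With a single base point, no cell condition
is needed. -/
theorem minkowski_polarSet_of_mem_convexHull {I : Set ι} {i : ι} (hi : i ∈ I) {x y : Euc n}
    (hx : x ∈ interCone P I) (hy : y ∈ convexHull ℝ ((fun j => matAct (Q j) x) '' I)) :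
    minkowski (polarSet S) y = ENNReal.ofReal (√(quadForm (polarMatrix P Q I i) y)) := by
  have hsub : ∀ k ∈ I, interCone P I ⊆ P k := fun k hk => Set.biInter_subset_of_mem hk
  have hconv : ∀ z : Euc n, ∀ c : ℝ, Convex ℝ {y : Euc n | inner ℝ y z ≤ c} := fun z c =>
    convex_halfSpace_le ⟨fun u v => inner_add_left u v z, fun t u => by
      rw [real_inner_smul_left, smul_eq_mul]⟩ c
  have hconv' : ∀ z : Euc n, ∀ c : ℝ, Convex ℝ {y : Euc n | inner ℝ y z = c} := fun z c =>
    convex_hyperplane ⟨fun u v => inner_add_left u v z, fun t u => by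
      rw [real_inner_smul_left, smul_eq_mul]⟩ c
  refine hS.minkowski_polarSet_eq hi hx ⟨fun z => ?_, ?_⟩ fun w hw => ?_
  · refine convexHull_min ?_ (hconv z _) hy
    rintro _ ⟨j, hj, rfl⟩
    exact (hS.isGaugeSubgradient_matAct (hsub j hj hx)).inner_le z
  · refine convexHull_min ?_ (hconv' x _) hy
    rintro _ ⟨j, hj, rfl⟩
    exact (hS.isGaugeSubgradient_matAct (hsub j hj hx)).inner_eq
  · refine convexHull_min ?_ (hconv' w _) hy
    rintro _ ⟨j, hj, rfl⟩
    exact hS.inner_matAct_eq (hsub j hj hx) (hsub i hi hx) (hsub j hj hw) (hsub i hi hw)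

/-- If `x ∈ P_i ∩ P_j`, then the subgradient `Q_j x` does not exceed `Q_i x` on `P_i`. -/
theorem inner_matAct_le {i j : ι} {x : Euc n} (hxi : x ∈ P i) (hxj : x ∈ P j) {d : Euc n}
    (hd : d ∈ P i) :
    inner ℝ (matAct (Q j) x) d ≤ inner ℝ (matAct (Q i) x) d := by
  refine le_of_forall_small_pos (b := 0) (d := quadForm (Q i) d / 2) one_pos fun t ht _ => ?_
  have hC := hS.partition.polyhedral i
  have h2 := hS.realGauge_sq (hC.add_mem hxi (hC.smul_mem hd ht.le))
  rw [quadForm_add_smul (hS.posSemidef i).isHermitian, ← hS.realGauge_sq hxi] at h2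
  have h := hS.isGaugeSubgradient_matAct hxj
  have h3 := h.inner_le (x + t • d)
  rw [inner_add_right, inner_smul_right, h.inner_eq] at h3
  refine le_of_mul_le_mul_left ?_ ht
  nlinarith [sq_nonneg (realGauge S x - realGauge S (x + t • d))]

section SumPair

variable [Fintype ι] {I : Set ι} {x y : Euc n}

theorem inner_eq_of_isSumPair (h : IsSumPair P Q I x y) {i : ι} (hi : i ∈ I) {w : Euc n}
    (hw : w ∈ interCone P I) : inner ℝ y w = inner ℝ (matAct (Q i) x) w := by
  have hsub : ∀ k ∈ I, interCone P I ⊆ P k := fun k hk => Set.biInter_subset_of_mem hk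
  obtain ⟨f, hf, hf0, rfl, rfl⟩ := h
  rw [matAct_sum, sum_inner, sum_inner]
  refine Finset.sum_congr rfl fun j _ => ?_
  by_cases hj : j ∈ I
  · exact hS.inner_matAct_eq (hsub j hj (hf j hj)) (hsub i hi (hf j hj)) (hsub j hj hw)
      (hsub i hi hw)
  · rw [hf0 j hj, matAct_zero, matAct_zero]

/-- On a cell, sums of subgradients are subgradients. -/
theorem isGaugeSubgradient_of_isSumPair (hI : IsCell P I) (hne : I.Nonempty)
    (h : IsSumPair P Q I x y) : IsGaugeSubgradient S x y := by
  have hsub : ∀ k ∈ I, interCone P I ⊆ P k := fun k hk => Set.biInter_subset_of_mem hk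
  have hx := h.fst_mem hS.partition.polyhedral
  obtain ⟨k, hk⟩ := hne
  refine ⟨fun z => ?_, ?_⟩
  swap
  · rw [hS.inner_eq_of_isSumPair h hk hx, (hS.isGaugeSubgradient_matAct (hsub k hk hx)).inner_eq]
  obtain ⟨x₀, hx₀, hcell⟩ := hI
  -- This `P i` contains `x₀`, hence all of `C_I`, so `Q_i` can be compared with each `Q_j` at `f
  -- j`. The comparison along `x₀ + t • z` reduces to one along `z`, because `y` and `Q_i x` agree
  -- at `x₀`.
  obtain ⟨i, hi, t, ht, hmem⟩ := hS.partition.exists_add_smul_mem x₀ z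
  have hCi := hcell i hi
  have hle : ∀ d ∈ P i, inner ℝ y d ≤ inner ℝ (matAct (Q i) x) d := by
    intro d hd
    obtain ⟨f, hf, hf0, rfl, rfl⟩ := h
    rw [matAct_sum, sum_inner, sum_inner]
    refine Finset.sum_le_sum fun j _ => ?_
    by_cases hj : j ∈ I
    · exact hS.inner_matAct_le (hCi (hf j hj)) (hsub j hj (hf j hj)) hd
    · rw [hf0 j hj, matAct_zero, matAct_zero]
  have h1 := hle _ hmem
  have h2 : inner ℝ y x₀ = inner ℝ (matAct (Q i) x) x₀ := by
    rw [hS.inner_eq_of_isSumPair h hk hx₀]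
    exact hS.inner_matAct_eq (hsub k hk hx) (hCi hx) (hsub k hk hx₀) (hCi hx₀)
  rw [inner_add_right, inner_add_right, h2, inner_smul_right, inner_smul_right] at h1
  have h3 : inner ℝ y z ≤ inner ℝ (matAct (Q i) x) z := by
    refine le_of_mul_le_mul_left ?_ ht
    linarith
  exact h3.trans ((hS.isGaugeSubgradient_matAct (hCi hx)).inner_le z)

theorem minkowski_polarSet_of_mem_polarCone (hI : IsCell P I) {i : ι} (hi : i ∈ I)
    (hy : y ∈ polarCone P Q I) :
    minkowski (polarSet S) y = ENNReal.ofReal (√(quadForm (polarMatrix P Q I i) y)) := by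
  obtain ⟨x, h⟩ := (mem_polarCone_iff hS.partition.polyhedral ⟨i, hi⟩).1 hy
  exact hS.minkowski_polarSet_eq hi (h.fst_mem hS.partition.polyhedral)
    (hS.isGaugeSubgradient_of_isSumPair hI ⟨i, hi⟩ h) fun w hw => hS.inner_eq_of_isSumPair h hi hw

end SumPair

end IsPiecewiseSemiEllipsoidOf

/-! ### Covering the domain of the polar gauge without overlap -/

namespace IsPiecewiseSemiEllipsoidOf

variable {n : ℕ} {ι : Type} {S : Set (Euc n)} {P : ι → Set (Euc n)}
  {Q : ι → Matrix (Fin n) (Fin n) ℝ} (hS : IsPiecewiseSemiEllipsoidOf S P Q)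
include hS

/-- A vector in the domain of the polar gauge is a limit of subgradients: `y - ε x` is a
subgradient at the minimiser `x` of a regularised problem. -/
theorem exists_isGaugeSubgradient_sub_smul {γ : ℝ} {y : Euc n}
    (hy : ∀ x, inner ℝ y x ≤ γ * realGauge S x) {ε : ℝ} (hε : 0 < ε) :
    ∃ x, IsGaugeSubgradient S x (y - ε • x) ∧ ε * ‖x‖ ^ 2 ≤ γ ^ 2 := by
  set h : Euc n → ℝ := fun x => realGauge S x ^ 2 + ε * ‖x‖ ^ 2 - 2 * inner ℝ y x with hh
  have hcont : Continuous h := by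
    have := hS.continuous_realGauge
    fun_prop
  have hbound : ∀ x, ε * ‖x‖ ^ 2 - γ ^ 2 ≤ h x := fun x => by
    have := hy x
    nlinarith [sq_nonneg (realGauge S x - γ)]
  have hlim : Filter.Tendsto h (Filter.cocompact _) Filter.atTop := by
    refine Filter.tendsto_atTop_mono hbound ?_
    refine Filter.tendsto_atTop_add_const_right _ _ (Filter.Tendsto.const_mul_atTop hε ?_)
    exact (Filter.tendsto_pow_atTop two_ne_zero).comp (tendsto_norm_cocompact_atTop (E := Euc n))
  obtain ⟨x, hx⟩ := hcont.exists_forall_le hlim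
  -- First-order optimality at the minimiser, with `c` bounding the growth rate of the gauge along
  -- `z`. The choices `(z, γ(z))`, `(x, γ(x))` and `(-x, -γ(x))` give the subgradient inequality and
  -- both halves of the equality.
  have hle : ∀ z : Euc n, ∀ t : ℝ, 0 < t → t < 1 → ∀ c : ℝ, 0 ≤ realGauge S x + t * c →
      realGauge S (x + t • z) ≤ realGauge S x + t * c →
      inner ℝ (y - ε • x) z ≤ realGauge S x * c + t * ((c ^ 2 + ε * ‖z‖ ^ 2) / 2) := by
    intro z t ht _ c hc0 hc
    have h1 := hx (x + t • z)
    have h2 := pow_le_pow_left₀ (realGauge_nonneg S _) hc 2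
    simp only [hh] at h1
    rw [norm_add_sq_real, inner_add_right, inner_smul_right, inner_smul_right, norm_smul,
      Real.norm_of_nonneg ht.le] at h1
    rw [inner_sub_left, real_inner_smul_left]
    refine le_of_mul_le_mul_left ?_ ht
    nlinarith
  have h0 := realGauge_nonneg S x
  refine ⟨x, ⟨fun z => ?_, le_antisymm ?_ ?_⟩, ?_⟩
  · refine le_of_forall_small_pos (b := 0)
      (d := (realGauge S z ^ 2 + ε * ‖z‖ ^ 2) / 2) one_pos fun t ht ht1 => ?_
    have h1 := hle z t ht ht1 (realGauge S z)
      (add_nonneg h0 (mul_nonneg ht.le (realGauge_nonneg S z)))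
      (hS.realGauge_add_smul_le x z ht.le)
    simpa using h1
  · refine le_of_forall_small_pos (b := 0)
      (d := (realGauge S x ^ 2 + ε * ‖x‖ ^ 2) / 2) one_pos fun t ht ht1 => ?_
    have h1 := hle x t ht ht1 (realGauge S x) (by positivity) (hS.realGauge_add_smul_le x x ht.le)
    rw [mul_zero, add_zero]
    linarith
  · refine le_of_forall_small_pos (b := 0)
      (d := ((-realGauge S x) ^ 2 + ε * ‖-x‖ ^ 2) / 2) one_pos fun t ht ht1 => ?_
    have h2 : realGauge S (x + t • -x) = (1 - t) * realGauge S x := by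
      rw [← hS.realGauge_smul x (by linarith), sub_smul, one_smul, smul_neg, sub_eq_add_neg]
    have h1 := hle (-x) t ht ht1 (-realGauge S x)
      (by nlinarith [mul_nonneg (sub_nonneg.2 ht1.le) h0]) (by rw [h2]; linarith)
    rw [inner_neg_right] at h1
    have h3 : realGauge S x ^ 2 + t * 0 ≤ inner ℝ (y - ε • x) x +
      t * (((-realGauge S x) ^ 2 + ε * ‖-x‖ ^ 2) / 2) := by linarith
    exact h3
  · have h1 := hx 0
    have h2 := hbound x
    have h3 : realGauge S 0 = 0 := by simpa using hS.realGauge_smul 0 le_rfl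
    have h4 : h 0 = 0 := by simp [hh, h3]
    linarith

theorem mem_iUnion_polarCone_of_isGaugeSubgradient {x y : Euc n}
    (h : IsGaugeSubgradient S x y) :
    y ∈ ⋃ I ∈ {I : Set ι | IsActive P I}, polarCone P Q I := by
  refine Set.mem_iUnion₂.2 ⟨{i | x ∈ P i}, ⟨x, rfl⟩, ?_⟩
  refine convexHull_mono ?_ (hS.mem_convexHull_of_isGaugeSubgradient h)
  rintro _ ⟨i, hi, rfl⟩
  exact Set.mem_iUnion₂.2 ⟨i, hi, x, Set.mem_iInter₂.2 fun _ hj => hj, rfl⟩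

section Fintype

variable [Fintype ι] {I J : Set ι} {x y : Euc n}

theorem isPolyhedralCone_polarCone (hne : I.Nonempty) : IsPolyhedralCone (polarCone P Q I) :=
  _root_.isPolyhedralCone_polarCone hS.partition.polyhedral hne

theorem isClosed_iUnion_polarCone {T : Set (Set ι)} (hT : ∀ I ∈ T, I.Nonempty) :
    IsClosed (⋃ I ∈ T, polarCone P Q I) :=
  (Set.toFinite T).isClosed_biUnion fun I hI => (hS.isPolyhedralCone_polarCone (hT I hI)).isClosed

/-- For the inclusion of the domain, nearby subgradients lie in the union, which is closed as a
finite union of polyhedral cones. -/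
theorem iUnion_polarCone_eq : ⋃ I ∈ {I : Set ι | IsActive P I}, polarCone P Q I =
    {y | minkowski (polarSet S) y < ∞} := by
  apply subset_antisymm
  · intro y hy
    obtain ⟨I, hI, hy⟩ := Set.mem_iUnion₂.1 hy
    obtain ⟨i, hi⟩ := IsActive.nonempty hS.partition hI
    rw [Set.mem_ofPred_eq, hS.minkowski_polarSet_of_mem_polarCone (IsActive.isCell hI) hi hy]
    exact ENNReal.ofReal_lt_top
  · intro y hy
    obtain ⟨γ, s, hs, rfl⟩ := exists_of_minkowski_lt_top hy
    have hle : ∀ x, inner ℝ ((γ : ℝ) • s) x ≤ γ * realGauge S x := fun x => by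
      rw [real_inner_smul_left]
      exact mul_le_mul_of_nonneg_left (inner_le_realGauge hS.minkowski_ne_top hs x) γ.2
    have hclosed := hS.isClosed_iUnion_polarCone (T := {I | IsActive P I})
      fun _ hI => IsActive.nonempty hS.partition hI
    rw [← hclosed.closure_eq, Metric.mem_closure_iff]
    intro δ hδ
    -- With this ε, ‖εx‖² = ε · ε‖x‖² ≤ εγ² < δ².
    obtain ⟨x, hx, hxn⟩ := hS.exists_isGaugeSubgradient_sub_smul hle
      (ε := δ ^ 2 / ((γ : ℝ) ^ 2 + 1)) (by positivity)
    refine ⟨_, hS.mem_iUnion_polarCone_of_isGaugeSubgradient hx, ?_⟩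
    rw [dist_eq_norm, sub_sub_cancel]
    refine lt_of_pow_lt_pow_left₀ 2 hδ.le ?_
    rw [norm_smul, Real.norm_of_nonneg (by positivity), mul_pow]
    have h1 : (0 : ℝ) < (γ : ℝ) ^ 2 + 1 := by positivity
    calc (δ ^ 2 / ((γ : ℝ) ^ 2 + 1)) ^ 2 * ‖x‖ ^ 2
        = δ ^ 2 / ((γ : ℝ) ^ 2 + 1) * (δ ^ 2 / ((γ : ℝ) ^ 2 + 1) * ‖x‖ ^ 2) := by ring
      _ ≤ δ ^ 2 / ((γ : ℝ) ^ 2 + 1) * (γ : ℝ) ^ 2 :=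
        mul_le_mul_of_nonneg_left hxn (by positivity)
      _ < δ ^ 2 := by
        rw [div_mul_eq_mul_div, div_lt_iff₀ h1]
        nlinarith [pow_pos hδ 2]

theorem realGauge_sq_of_isSumPair {i : ι} (hi : i ∈ I)
    (h : IsSumPair P Q I x y) : realGauge S x ^ 2 = quadForm (polarMatrix P Q I i) y := by
  have hx := h.fst_mem hS.partition.polyhedral
  rw [hS.realGauge_sq (Set.mem_iInter₂.1 hx i hi), quadForm_polarMatrix P Q
    (hS.isPolyhedralCone_interCone I).zero_mem (hS.posSemidef i).isHermitian hx fun w hw =>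
      hS.inner_eq_of_isSumPair h hi hw]

/-- If `y ∈ K_I` is a subgradient at `x`, then `x` does not exceed the gradient `M_I y` in a
direction in which the ray from `y` starts in `K_I`. -/
theorem inner_le_inner_polarMatrix (hI : IsCell P I) {i : ι} (hi : i ∈ I)
    (hy : y ∈ polarCone P Q I) (h : IsGaugeSubgradient S x y) {d : Euc n} {r : ℝ} (hr : 0 < r)
    (hd : ∀ t : ℝ, 0 < t → t < r → y + t • d ∈ polarCone P Q I) :
    inner ℝ d x ≤ inner ℝ d (matAct (polarMatrix P Q I i) y) := by
  have hP := hS.partition.polyhedral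
  have hM := (posSemidef_polarMatrix P Q I (hS.posSemidef i)).isHermitian
  have hgx : realGauge S x ^ 2 = quadForm (polarMatrix P Q I i) y := by
    obtain ⟨x', h'⟩ := (mem_polarCone_iff hP ⟨i, hi⟩).1 hy
    rw [← hS.realGauge_sq_of_isSumPair hi h']
    have h1 := h.minkowski_polarSet hS.minkowski_ne_top
    rw [(hS.isGaugeSubgradient_of_isSumPair hI ⟨i, hi⟩ h').minkowski_polarSet
      hS.minkowski_ne_top, ENNReal.ofReal_eq_ofReal_iff (realGauge_nonneg _ _)
      (realGauge_nonneg _ _)] at h1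
    rw [h1]
  refine le_of_forall_small_pos (b := 0) (d := quadForm (polarMatrix P Q I i) d / 2) hr
    fun t ht htr => ?_
  -- The vector `y + t • d` is a subgradient at `x'`, so γ(x')² is the form of `M_I` at it. Pairing
  -- it with `x` gives at most γ(x')γ(x); the first-order terms in `t` yield the claim.
  obtain ⟨x', h'⟩ := (mem_polarCone_iff hP ⟨i, hi⟩).1 (hd t ht htr)
  have h1 := hS.realGauge_sq_of_isSumPair hi h'
  have h2 := (hS.isGaugeSubgradient_of_isSumPair hI ⟨i, hi⟩ h').inner_le x
  rw [quadForm_add_smul hM, ← hgx, real_inner_comm] at h1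
  rw [inner_add_left, real_inner_smul_left, h.inner_eq] at h2
  refine le_of_mul_le_mul_left ?_ ht
  nlinarith [sq_nonneg (realGauge S x' - realGauge S x)]

/-- In the interior of `K_I`, the point at which `y` is a subgradient is `M_I y`. -/
theorem eq_matAct_of_mem_interior (hI : IsCell P I) {i : ι} (hi : i ∈ I)
    (hy : y ∈ interior (polarCone P Q I)) (h : IsGaugeSubgradient S x y) :
    x = matAct (polarMatrix P Q I i) y := by
  have hle : ∀ d : Euc n, inner ℝ d x ≤ inner ℝ d (matAct (polarMatrix P Q I i) y) := by
    intro d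
    have h1 : Continuous fun t : ℝ => y + t • d := by fun_prop
    have h2 := h1.tendsto 0
    rw [zero_smul, add_zero] at h2
    obtain ⟨r, hr, h3⟩ := Metric.eventually_nhds_iff.1
      (h2.eventually (mem_interior_iff_mem_nhds.1 hy))
    exact hS.inner_le_inner_polarMatrix hI hi (interior_subset hy) h hr fun t ht htr =>
      h3 (by rwa [Real.dist_eq, sub_zero, abs_of_pos ht])
  refine ext_inner_left ℝ fun d => le_antisymm (hle d) ?_
  have h1 := hle (-d)
  rw [inner_neg_left, inner_neg_left] at h1
  linarith

/-- On a full-dimensional cone `K_I`, the gradient `M_I y` is the sum that belongs to `y`. -/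
theorem eq_matAct_of_isSumPair (hI : IsCell P I) {i : ι} (hi : i ∈ I)
    (hint : (interior (polarCone P Q I)).Nonempty) (h : IsSumPair P Q I x y) :
    x = matAct (polarMatrix P Q I i) y := by
  have hP := hS.partition.polyhedral
  obtain ⟨y₀, hy₀⟩ := hint
  obtain ⟨x₀, h₀⟩ := (mem_polarCone_iff hP ⟨i, hi⟩).1 (interior_subset hy₀)
  have h1 := hS.eq_matAct_of_mem_interior hI hi hy₀
    (hS.isGaugeSubgradient_of_isSumPair hI ⟨i, hi⟩ h₀)
  -- Adding an interior point moves `y` into the interior; its contribution then cancels by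
  -- linearity.
  have h2 := hS.eq_matAct_of_mem_interior hI hi
    ((hS.isPolyhedralCone_polarCone ⟨i, hi⟩).add_mem_interior
      ((mem_polarCone_iff hP ⟨i, hi⟩).2 ⟨x, h⟩) hy₀)
    (hS.isGaugeSubgradient_of_isSumPair hI ⟨i, hi⟩ (h.add hP h₀))
  rw [matAct_add, ← h1] at h2
  exact add_right_cancel h2

/-- An interior point of `K_I`, `I` active, is a subgradient only at a point whose active set
is `I`. -/
theorem setOf_mem_matAct_eq (hI : IsActive P I) {i : ι} (hi : i ∈ I)
    (hy : y ∈ interior (polarCone P Q I)) (h : IsGaugeSubgradient S x y) :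
    {j | x ∈ P j} = I := by
  have hP := hS.partition.polyhedral
  obtain ⟨x₁, hx₁⟩ := id hI
  have hx₁I : x₁ ∈ interCone P I := by
    rw [hx₁]
    exact Set.mem_iInter₂.2 fun _ hj => hj
  -- Subtracting a small multiple of `Q_i x₁` from `y` stays in `K_I`. Hence `x = x' + t • x₁` with
  -- `x' ∈ C_I`, and such a point has the same active set as `x₁`.
  have h1 : Continuous fun t : ℝ => y - t • matAct (Q i) x₁ := by fun_prop
  have h2 := h1.tendsto 0
  rw [zero_smul, sub_zero] at h2
  obtain ⟨t, hmem, ht⟩ := (((h2.mono_left nhdsWithin_le_nhds).eventually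
    (mem_interior_iff_mem_nhds.1 hy)).and (self_mem_nhdsWithin (s := Set.Ioi (0 : ℝ)))).exists
  obtain ⟨x', h'⟩ := (mem_polarCone_iff hP ⟨i, hi⟩).1 hmem
  have h3 := h'.add hP ((IsSumPair.of_mem (Q := Q) hP hi hx₁I).smul hP (le_of_lt ht))
  rw [sub_add_cancel] at h3
  have h4 : x = x' + t • x₁ := by
    rw [hS.eq_matAct_of_mem_interior (IsActive.isCell hI) hi hy h]
    exact (hS.eq_matAct_of_mem_interior (IsActive.isCell hI) hi hy
      (hS.isGaugeSubgradient_of_isSumPair (IsActive.isCell hI) ⟨i, hi⟩ h3)).symm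
  have h5 := h'.fst_mem hP
  rw [hx₁] at h5
  rw [h4, hS.partition.setOf_mem_add_smul h5 ht, ← hx₁]

/-- A common interior point would be a subgradient at a point whose active set is both `I` and `J`.
-/
theorem affDim_polarCone_inter_lt (hI : IsActive P I) (hJ : IsActive P J) (hIJ : I ≠ J) :
    affDim (polarCone P Q I ∩ polarCone P Q J) < n := by
  obtain ⟨i, hi⟩ := IsActive.nonempty hS.partition hI
  obtain ⟨j, hj⟩ := IsActive.nonempty hS.partition hJ
  have hKI := hS.isPolyhedralCone_polarCone (Q := Q) ⟨i, hi⟩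
  have hKJ := hS.isPolyhedralCone_polarCone (Q := Q) ⟨j, hj⟩
  refine affDim_lt_of_interior_eq_empty (hKI.convex.inter hKJ.convex)
    ⟨0, hKI.zero_mem, hKJ.zero_mem⟩ ?_
  by_contra hne
  obtain ⟨y, hy⟩ := Set.nonempty_iff_ne_empty.2 hne
  rw [interior_inter] at hy
  obtain ⟨x, h⟩ := (mem_polarCone_iff hS.partition.polyhedral ⟨i, hi⟩).1 (interior_subset hy.1)
  have h' := hS.isGaugeSubgradient_of_isSumPair (IsActive.isCell hI) ⟨i, hi⟩ h
  exact hIJ ((hS.setOf_mem_matAct_eq hI hi hy.1 h').symm.trans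
    (hS.setOf_mem_matAct_eq hJ hj hy.2 h'))

end Fintype

end IsPiecewiseSemiEllipsoidOf

/-! ### Boundedness and the representation of the polar -/

section Bounded

variable {n : ℕ} {S : Set (Euc n)}

theorem minkowski_polarSet_lt_top (hS : Bornology.IsBounded S) (y : Euc n) :
    minkowski (polarSet S) y < ∞ := by
  obtain ⟨R, hR, hSR⟩ := hS.exists_pos_norm_le
  have hc : 0 < R * (‖y‖ + 1) := by positivity
  have h1 : (R * (‖y‖ + 1))⁻¹ • y ∈ polarSet S := fun x hx => by
    rw [real_inner_smul_left, inv_mul_le_iff₀ hc]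
    have h2 := real_inner_le_norm y x
    have h3 := mul_le_mul_of_nonneg_left (hSR x hx) (norm_nonneg y)
    nlinarith
  have h2 := minkowski_le (γ := (R * (‖y‖ + 1)).toNNReal) h1
  rw [Real.coe_toNNReal _ hc.le, smul_inv_smul₀ hc.ne'] at h2
  exact h2.trans_lt ENNReal.coe_lt_top

/-- Finiteness at a vector bounds the corresponding linear functional on `S`; the vectors `±e_k`
bound all coordinates. -/
theorem isBounded_of_minkowski_polarSet_lt_top (h : ∀ y, minkowski (polarSet S) y < ∞) :
    Bornology.IsBounded S := by
  have h1 : ∀ y : Euc n, ∃ c : ℝ, ∀ x ∈ S, inner ℝ y x ≤ c := fun y => by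
    obtain ⟨γ, s, hs, rfl⟩ := exists_of_minkowski_lt_top (h y)
    refine ⟨γ, fun x hx => ?_⟩
    rw [real_inner_smul_left]
    exact mul_le_of_le_one_right γ.2 (hs x hx)
  choose c hc using h1
  let e : Fin n → Euc n := fun k => EuclideanSpace.single k 1
  refine isBounded_iff_forall_norm_le.2 ⟨√(∑ k, (max (c (e k)) (c (-e k))) ^ 2), fun x hx => ?_⟩
  rw [EuclideanSpace.norm_eq]
  refine Real.sqrt_le_sqrt (Finset.sum_le_sum fun k _ => ?_)
  have hk : inner ℝ (e k) x = x k := by simp [e, EuclideanSpace.inner_single_left]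
  have h2 := hc (e k) x hx
  have h3 := hc (-e k) x hx
  rw [inner_neg_left] at h3
  rw [hk] at h2 h3
  refine pow_le_pow_left₀ (norm_nonneg _) ?_ 2
  rw [Real.norm_eq_abs]
  exact abs_le.2 ⟨by linarith [le_max_right (c (e k)) (c (-e k))],
    h2.trans (le_max_left _ _)⟩

end Bounded

/-- The orthogonal complement of a hyperplane is a line. This makes the gradient jump across a
common facet a multiple of its normal. -/
theorem exists_eq_smul_of_forall_inner_eq_zero {n : ℕ} {W : Set (Euc n)}
    (h0 : (0 : Euc n) ∈ W) (hW : affDim W + 1 = n) {v D : Euc n} (hv : v ≠ 0)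
    (hvW : ∀ w ∈ W, inner ℝ v w = 0) (hDW : ∀ w ∈ W, inner ℝ w D = 0) : ∃ a : ℝ, D = a • v := by
  have horth : ∀ u : Euc n, (∀ w ∈ W, inner ℝ w u = 0) → u ∈ (Submodule.span ℝ W)ᗮ := by
    intro u hu
    rw [Submodule.mem_orthogonal]
    intro w hw
    induction hw using Submodule.span_induction with
    | mem w hw => exact hu w hw
    | zero => simp
    | add p q _ _ hp hq => rw [inner_add_left, hp, hq, add_zero]
    | smul t p _ hp => rw [real_inner_smul_left, hp, mul_zero]
  have h1 := (Submodule.span ℝ W).finrank_add_finrank_orthogonal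
  rw [affDim, vectorSpan_eq_span_of_zero_mem h0] at hW
  rw [finrank_euclideanSpace_fin] at h1
  have h2 : Module.finrank ℝ (Submodule.span ℝ W)ᗮ = 1 := by omega
  have hvm := horth v fun w hw => by rw [real_inner_comm]; exact hvW w hw
  have hDm := horth D hDW
  obtain ⟨a, ha⟩ := exists_smul_eq_of_finrank_eq_one h2
    (x := ⟨v, hvm⟩) (fun h => hv (congrArg Subtype.val h)) ⟨D, hDm⟩
  exact ⟨a, (congrArg Subtype.val ha).symm⟩

namespace IsPiecewiseSemiEllipsoidOf

variable {n : ℕ} {ι κ : Type} {S : Set (Euc n)} {P : ι → Set (Euc n)}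
  {Q : ι → Matrix (Fin n) (Fin n) ℝ} (hS : IsPiecewiseSemiEllipsoidOf S P Q)
include hS

theorem comp_equiv (e : κ ≃ ι) : IsPiecewiseSemiEllipsoidOf S (P ∘ e) (Q ∘ e) where
  isClosed := hS.isClosed
  convex := hS.convex
  zero_mem := hS.zero_mem
  partition :=
    { finite := have := hS.partition.finite; Finite.of_equiv ι e.symm
      polyhedral := fun k => hS.partition.polyhedral (e k)
      interior_nonempty := fun k => hS.partition.interior_nonempty (e k)
      dim_inter_lt := fun k l h => hS.partition.dim_inter_lt _ _ (e.injective.ne h)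
      cover := by
        rw [← hS.partition.cover]
        exact e.surjective.iUnion_comp P }
  posSemidef := fun k => hS.posSemidef (e k)
  minkowski_eq := fun k => hS.minkowski_eq (e k)
  continuity := fun k l => hS.continuity (e k) (e l)
  convexity := fun k l => hS.convexity (e k) (e l)

theorem isPiecewiseSemiEllipsoidal : IsPiecewiseSemiEllipsoidal S := by
  have := hS.partition.finite
  obtain ⟨m, ⟨e⟩⟩ := Finite.exists_equiv_fin ι
  exact ⟨m, _, _, hS.comp_equiv e.symm⟩

variable [Fintype ι]

/-- The full-dimensional cones have a closed union, whose complement is open and covered by the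
finitely many lower-dimensional ones; it is therefore empty. -/
theorem isConicPartition_polarCone (hb : Bornology.IsBounded S) :
    IsConicPartition fun I : PolarIndex P Q => polarCone P Q I.1 where
  finite := Subtype.finite
  polyhedral := fun I => hS.isPolyhedralCone_polarCone (IsActive.nonempty hS.partition I.2.1)
  interior_nonempty := fun I => I.2.2
  dim_inter_lt := fun I J h =>
    hS.affDim_polarCone_inter_lt I.2.1 J.2.1 fun h' => h (Subtype.ext h')
  cover := by
    have hclosed := hS.isClosed_iUnion_polarCone (Q := Q)
      (T := {I | IsActive P I ∧ (interior (polarCone P Q I)).Nonempty})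
      fun I hI => IsActive.nonempty hS.partition hI.1
    have h := hclosed.isOpen_compl.eq_empty_of_subset_iUnion_of_affDim_lt
      (κ := {I : Set ι // IsActive P I ∧ interior (polarCone P Q I) = ∅})
      (C := fun I => polarCone P Q I.1) (fun I => by
        have hK := hS.isPolyhedralCone_polarCone (Q := Q) (IsActive.nonempty hS.partition I.2.1)
        exact affDim_lt_of_interior_eq_empty hK.convex ⟨0, hK.zero_mem⟩ I.2.2) (by
        intro y hy
        have h1 : y ∈ ⋃ I ∈ {I : Set ι | IsActive P I}, polarCone P Q I := by
          rw [hS.iUnion_polarCone_eq]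
          exact minkowski_polarSet_lt_top hb y
        obtain ⟨I, hI, hyI⟩ := Set.mem_iUnion₂.1 h1
        refine Set.mem_iUnion.2 ⟨⟨I, hI, ?_⟩, hyI⟩
        by_contra hne
        exact hy (Set.mem_iUnion₂.2 ⟨I, ⟨hI, Set.nonempty_iff_ne_empty.2 hne⟩, hyI⟩))
    rw [Set.compl_empty_iff] at h
    refine Set.eq_univ_of_forall fun y => ?_
    obtain ⟨I, hI, hyI⟩ := Set.mem_iUnion₂.1 (h ▸ Set.mem_univ y)
    exact Set.mem_iUnion.2 ⟨⟨I, hI⟩, hyI⟩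

/-- The gradient jump of the polar gauge is nonnegative in the directions of `K_I`. -/
theorem inner_matAct_polarMatrix_le {I J : Set ι} (hI : IsCell P I) (hJ : IsCell P J) {i j : ι}
    (hi : i ∈ I) (hj : j ∈ J) (hint : (interior (polarCone P Q J)).Nonempty) {y d : Euc n}
    (hyI : y ∈ polarCone P Q I) (hyJ : y ∈ polarCone P Q J) (hd : d ∈ polarCone P Q I) :
    inner ℝ d (matAct (polarMatrix P Q J j) y) ≤ inner ℝ d (matAct (polarMatrix P Q I i) y) := by
  obtain ⟨x, h⟩ := (mem_polarCone_iff hS.partition.polyhedral ⟨j, hj⟩).1 hyJ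
  rw [← hS.eq_matAct_of_isSumPair hJ hj hint h]
  have hK := hS.isPolyhedralCone_polarCone (Q := Q) ⟨i, hi⟩
  exact hS.inner_le_inner_polarMatrix hI hi hyI
    (hS.isGaugeSubgradient_of_isSumPair hJ ⟨j, hj⟩ h) one_pos fun t ht _ =>
      hK.add_mem hyI (hK.smul_mem hd ht.le)

/-- The polar of a bounded piecewise semi-ellipsoid is a piecewise semi-ellipsoid. -/
theorem polarSet (hb : Bornology.IsBounded S) (c : PolarIndex P Q → ι) (hc : ∀ I, c I ∈ I.1) :
    IsPiecewiseSemiEllipsoidOf (polarSet S) (fun I : PolarIndex P Q => polarCone P Q I.1)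
      (fun I => polarMatrix P Q I.1 (c I)) := by
  have hpsd : ∀ I : PolarIndex P Q, (polarMatrix P Q I.1 (c I)).PosSemidef := fun I =>
    posSemidef_polarMatrix P Q I.1 (hS.posSemidef (c I))
  have hmin : ∀ I : PolarIndex P Q, ∀ y ∈ polarCone P Q I.1, minkowski (_root_.polarSet S) y =
      ENNReal.ofReal (√(quadForm (polarMatrix P Q I.1 (c I)) y)) := fun I y hy =>
    hS.minkowski_polarSet_of_mem_polarCone (IsActive.isCell I.2.1) (hc I) hy
  refine ⟨isClosed_polarSet, convex_polarSet, zero_mem_polarSet,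
    hS.isConicPartition_polarCone hb, hpsd, hmin, fun I J _ y hy => ?_, fun I J hdim v hv hvW hvK
      y hy => ?_⟩
  · have h := (hmin I y hy.1).symm.trans (hmin J y hy.2)
    rwa [ENNReal.ofReal_eq_ofReal_iff (Real.sqrt_nonneg _) (Real.sqrt_nonneg _),
      Real.sqrt_inj ((hpsd I).quadForm_nonneg y) ((hpsd J).quadForm_nonneg y)] at h
  · have hle := fun d hd => hS.inner_matAct_polarMatrix_le (d := d) (IsActive.isCell I.2.1)
      (IsActive.isCell J.2.1) (hc I) (hc J) J.2.2 hy.1 hy.2 hd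
    have hge := fun d hd => hS.inner_matAct_polarMatrix_le (d := d) (IsActive.isCell J.2.1)
      (IsActive.isCell I.2.1) (hc J) (hc I) I.2.2 hy.2 hy.1 hd
    have hKI := hS.isPolyhedralCone_polarCone (Q := Q) ⟨_, hc I⟩
    have hKJ := hS.isPolyhedralCone_polarCone (Q := Q) ⟨_, hc J⟩
    -- The two opposite gradient inequalities show that the jump is orthogonal to the common facet.
    obtain ⟨a, ha⟩ := exists_eq_smul_of_forall_inner_eq_zero
      (W := polarCone P Q I.1 ∩ polarCone P Q J.1) ⟨hKI.zero_mem, hKJ.zero_mem⟩ hdim hv hvW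
      (D := matAct (polarMatrix P Q I.1 (c I)) y - matAct (polarMatrix P Q J.1 (c J)) y)
      fun w hw => by
        rw [inner_sub_right, sub_eq_zero]
        exact le_antisymm (hge w hw.2) (hle w hw.1)
    have hvv : 0 < inner ℝ v v := real_inner_self_pos.2 hv
    -- The sign of `a` is read off at `p + t • v ∈ K_I`, whose pairing with `v` is strictly
    -- positive.
    obtain ⟨p, hp⟩ := I.2.2
    have hcont : Continuous fun t : ℝ => p + t • v := by fun_prop
    have hlim := hcont.tendsto 0
    rw [zero_smul, add_zero] at hlim
    obtain ⟨t, hmem, ht⟩ := (((hlim.mono_left nhdsWithin_le_nhds).eventually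
      (mem_interior_iff_mem_nhds.1 hp)).and (self_mem_nhdsWithin (s := Set.Ioi (0 : ℝ)))).exists
    have h1 := sub_nonneg.2 (hle _ hmem)
    rw [← inner_sub_right, ha, inner_smul_right, inner_add_left, real_inner_smul_left,
      real_inner_comm] at h1
    have h2 : 0 < inner ℝ v p + t * inner ℝ v v :=
      add_pos_of_nonneg_of_pos (hvK p (interior_subset hp)) (mul_pos ht hvv)
    have h3 : 0 ≤ a := nonneg_of_mul_nonneg_left h1 h2
    have h4 : 0 ≤ inner ℝ v (matAct (polarMatrix P Q I.1 (c I)) y) -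
        inner ℝ v (matAct (polarMatrix P Q J.1 (c J)) y) := by
      rw [← inner_sub_right, ha, inner_smul_right]
      exact mul_nonneg h3 hvv.le
    exact sub_nonneg.1 h4

theorem isBounded_iff :
    Bornology.IsBounded S ↔ IsPiecewiseSemiEllipsoidal (_root_.polarSet S) := by
  constructor
  · intro hb
    have h : ∀ I : PolarIndex P Q, ∃ i, i ∈ I.1 := fun I =>
      IsActive.nonempty hS.partition I.2.1
    choose c hc using h
    exact (hS.polarSet hb c hc).isPiecewiseSemiEllipsoidal
  · rintro ⟨m, P', Q', h⟩
    exact isBounded_of_minkowski_polarSet_lt_top fun y => (h.minkowski_ne_top y).lt_top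

end IsPiecewiseSemiEllipsoidOf

theorem mainTheorem3 (n m : ℕ) (S : Set (Euc n)) (P : Fin m → Set (Euc n))
    (Q : Fin m → Matrix (Fin n) (Fin n) ℝ) (hS : IsPiecewiseSemiEllipsoidOf S P Q) :
    -- the cones of the description are polyhedral
    (∀ i, IsPolyhedralCone (matAct (Q i) '' P i)) ∧
    (∀ I : Set (Fin m), I.Nonempty → IsPolyhedralCone (polarCone P Q I)) ∧
    -- the matrix of a cone does not depend on the index that is chosen in `I`
    (∀ I : Set (Fin m), ∀ i ∈ I, ∀ j ∈ I,
      projMatrix P I * Q i * (projMatrix P I)ᵀ = projMatrix P I * Q j * (projMatrix P I)ᵀ) ∧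
    -- the Minkowski function of the polar on `Q_i P_i`
    (∀ i, ∀ y ∈ matAct (Q i) '' P i,
      minkowski (polarSet S) y = ENNReal.ofReal (√(quadForm (pinv (Q i)) y))) ∧
    -- the Minkowski function of the polar on `conv_{i ∈ I} Q_i (⋂_{j ∈ I} P_j)`
    (∀ I : Set (Fin m), IsCell P I → ∀ i ∈ I, ∀ y ∈ polarCone P Q I,
      minkowski (polarSet S) y = ENNReal.ofReal (√(quadForm (polarMatrix P Q I i) y))) ∧
    (IsFaceToFace P → ∀ I : Set (Fin m), ∀ i ∈ I, ∀ y ∈ polarCone P Q I,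
      minkowski (polarSet S) y = ENNReal.ofReal (√(quadForm (polarMatrix P Q I i) y))) ∧
    -- for every `I`, the same formula on the convex hull of the `Q_i x`, `i ∈ I`
    (∀ I : Set (Fin m), ∀ x ∈ interCone P I, ∀ i ∈ I,
      ∀ y ∈ convexHull ℝ ((fun j => matAct (Q j) x) '' I),
        minkowski (polarSet S) y = ENNReal.ofReal (√(quadForm (polarMatrix P Q I i) y))) ∧
    -- the cones `Q_i P_i` with `Q_i⁺` belong to the family indexed by the active sets
    (∀ i, IsActive P {i} ∧ polarCone P Q {i} = matAct (Q i) '' P i ∧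
      polarMatrix P Q {i} i = pinv (Q i)) ∧
    -- the cones of this family cover the domain of the Minkowski function, without overlap
    (⋃ I ∈ {I : Set (Fin m) | IsActive P I}, polarCone P Q I =
      {y | minkowski (polarSet S) y < ∞}) ∧
    (∀ I J : Set (Fin m), IsActive P I → IsActive P J → I ≠ J →
      affDim (polarCone P Q I ∩ polarCone P Q J) < n) ∧
    -- if `S` is bounded, then its polar is the piecewise semi-ellipsoid that they represent
    (Bornology.IsBounded S ↔ IsPiecewiseSemiEllipsoidal (polarSet S)) ∧
    (Bornology.IsBounded S →
      ∀ c : PolarIndex P Q → Fin m, (∀ I, c I ∈ I.1) →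
        IsPiecewiseSemiEllipsoidOf (polarSet S) (fun I : PolarIndex P Q => polarCone P Q I.1)
          (fun I => polarMatrix P Q I.1 (c I))) := by
  have hP := hS.partition.polyhedral
  have hsing : ∀ i, IsActive P {i} ∧ polarCone P Q {i} = matAct (Q i) '' P i ∧
      polarMatrix P Q {i} i = pinv (Q i) := fun i =>
    ⟨hS.partition.isActive_singleton i, polarCone_singleton hP i,
      polarMatrix_singleton P Q (hS.partition.interior_nonempty i)⟩
  refine ⟨fun i => isPolyhedralCone_image (hP i) (Q i), fun I hI =>
    hS.isPolyhedralCone_polarCone hI, fun I i hi j hj => hS.projMatrix_mul_mul_eq hi hj,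
    fun i y hy => ?_, fun I hI i hi y hy => hS.minkowski_polarSet_of_mem_polarCone hI hi hy,
    fun hF I i hi y hy => hS.minkowski_polarSet_of_mem_polarCone
      (hS.partition.isCell_of_isFaceToFace hF ⟨i, hi⟩) hi hy,
    fun I x hx i hi y hy => hS.minkowski_polarSet_of_mem_convexHull hi hx hy, hsing,
    hS.iUnion_polarCone_eq, fun I J hI hJ hIJ => hS.affDim_polarCone_inter_lt hI hJ hIJ,
    hS.isBounded_iff, fun hb c hc => hS.polarSet hb c hc⟩
  obtain ⟨h1, h2, h3⟩ := hsing i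
  rw [← h2] at hy
  rw [← h3]
  exact hS.minkowski_polarSet_of_mem_polarCone (IsActive.isCell h1) rfl hy
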